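/- For a permutation $p=p_1p_2\cdots p_n$ of $\{1,\dots,n\}$, let $s(p)$ be the output obtained by passing $p$ through a stack as follows: the entries are read from left to right; when $p_i$ is read, the top entry $r$ of the stack is moved to the next free position of the output as long as the stack is non-empty and $r<p_i$, and then $p_i$ is put on top of the stack; after all entries have been read, the stack is emptied into the output from top to bottom. For $t\ge 0$, call $p$ $t$-stack sortable if $s^t(p)=12\cdots n$, and let $W_t(n)$ be the number of $t$-stack sortable permutations of length $n$. Then for every integer $n\ge 1$, \[ W_3(n)\;\le\;\sum_{k=1}^{\lfloor (n+1)/2\rfloor} \frac{(n+k-1)!\,(2n-k)!}{k!\,(n+1-k)!\,(2k-1)!\,(2n-2k+1)!}\binom{2n-2k}{n-1}. \] -/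

import Mathlib

open scoped Nat

/-- The run of the stack on the remaining `input`, where the second list is the current content
of the stack, top entry first; the value is the remaining output. To process the next entry `x`,
entries `r` are popped to the output as long as the top entry `r` does not satisfy `x < r`; then `x`
is pushed. When the input is exhausted the stack is emptied into the output from the top. -/
def stackRun {α : Type*} [LinearOrder α] : List α → List α → List α
  | [], stack => stack
  | x :: input, stack =>
      stack.takeWhile (fun r => decide (¬ x < r)) ++
        stackRun input (x :: stack.dropWhile (fun r => decide (¬ x < r)))

/-- The stack sorting operation `s`: the run on the given word starting with an empty stack. -/
def stackSort {α : Type*} [LinearOrder α] (l : List α) : List α :=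
  stackRun l []

/-- `p` is `t`-stack sortable: applying `s` to its one-line notation `t` times gives the one-line
notation of the identity permutation. Permutations of length `n` are permutations of
`Fin n = {0, …, n - 1}`. -/
def IsStackSortable (t : ℕ) {n : ℕ} (p : Equiv.Perm (Fin n)) : Prop :=
  stackSort^[t] (List.ofFn p) = List.finRange n

/-- `W_t(n)`, the number of `t`-stack sortable permutations of length `n`. -/
noncomputable def numStackSortable (t n : ℕ) : ℕ :=
  Nat.card {p : Equiv.Perm (Fin n) // IsStackSortable t p}

/-!
The permutation `p` is `3`-stack sortable exactly if `q = s(p)` is `2`-stack sortable, so the number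
of `3`-stack sortable permutations is the sum of the fibre sizes of `s` over `2`-stack sortable `q`.

*Fibres.* Record, before each of the `n` pops, the number of pushes since the previous pop.
Together with `q` this determines `p` (`taggedRun_injective`). The numbers add up to `n`, the first
is positive, and at each descent of `q` the number is at least `2`: the first letter of the descent
leaves because a larger letter is about to be pushed, and the second letter of the descent is
neither that letter nor below the first one in the stack (`isChain_taggedRun`). For `k - 1` descents
this leaves `n - 2k + 1` free pushes, hence at most `(2n - 2k).choose (n - 1)` preimages
(`card_fiber_le`).

*Two-stack sortable permutations.* Write such a permutation as `L n R`. The maximum of `L` is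
inserted into `R` at a cut of `s(R)`, all other letters of `L` are smaller than those of `R`, and
the number of components of the image is controlled (`exists_glue`, `numComponents_glue`). Marking
descents by `X`, ascents by `Y` and components by a catalytic variable `v`, the encodings have a generating function
`F` with

  `F = v (1 + (X + Y) F + X Y F (v F - F₁) / (v - 1))`,  where `F₁` is `F` at `v = 1`.

This equation has a unique solution (`CatalyticEq.unique`), and the solution is explicit: let
`X = U (1 - V) ^ 2`, `Y = V (1 - U) ^ 2` and `W = v (1 + U (1 - V) W) (1 + V (1 - U) W)`; then
`F = W - U V W ^ 2` and `F₁ = (1 - U - V) / ((1 - U) ^ 2 (1 - V) ^ 2)`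
(`evalZero_eq_closedSeries`). Lagrange inversion in the variable `X` over `ℚ⟦Y⟧`
(`coeff_lagrange`) gives the coefficients

  `(2d + e + 1)! (d + 2e + 1)! / ((d + 1)! (e + 1)! (2d + 1)! (2e + 1)!)`

of `F₁` (`coeff_closedSeries`), which for `d = k - 1`, `e = n - k` is the factor in the bound.
-/

/-! ### Lagrange inversion -/

namespace PowerSeries

section Lagrange

variable {A : Type*} [CommRing A]

/-- The series whose `n`-th coefficient is `[u ^ n] H (Φ ^ n - u Φ' Φ ^ (n - 1))`. By Lagrange's
formula this is `H(U)` for the solution `U` of `U = X Φ(U)`, but it is taken as the definition, so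
that no composition of series is needed. For `n = 0` the truncated exponent `n - 1` is harmless:
the second term is divisible by `X`. -/
noncomputable def lagrangeFun (Φ H : A⟦X⟧) : A⟦X⟧ :=
  PowerSeries.mk fun n => coeff n (H * (Φ ^ n - X * derivative A Φ * Φ ^ (n - 1)))

theorem derivative_mul (f g : A⟦X⟧) :
    derivative A (f * g) = f * derivative A g + g * derivative A f := by
  rw [Derivation.leibniz, smul_eq_mul, smul_eq_mul]

theorem derivative_sub (f g : A⟦X⟧) :
    derivative A (f - g) = derivative A f - derivative A g :=
  map_sub _ f g

theorem lagrangeFun_add (Φ H K : A⟦X⟧) :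
    lagrangeFun Φ (H + K) = lagrangeFun Φ H + lagrangeFun Φ K := by
  ext n
  simp [lagrangeFun, add_mul]

theorem lagrangeFun_C_mul (Φ H : A⟦X⟧) (a : A) :
    lagrangeFun Φ (C a * H) = C a * lagrangeFun Φ H := by
  ext n
  simp [lagrangeFun, mul_assoc]

/-- Together with linearity and `lagrangeFun_one` this rule determines `lagrangeFun Φ`. -/
theorem lagrangeFun_X_mul (Φ H : A⟦X⟧) :
    lagrangeFun Φ (X * H) = X * lagrangeFun Φ (Φ * H) := by
  ext n
  cases n with
  | zero => simp [lagrangeFun]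
  | succ n =>
    simp only [lagrangeFun, coeff_succ_X_mul, coeff_mk, mul_assoc]
    cases n with
    | zero => simp [mul_sub]; ring
    | succ n =>
      congr 1
      simp only [Nat.add_sub_cancel]
      ring

theorem lagrangeFun_one [Algebra ℚ A] (Φ : A⟦X⟧) : lagrangeFun Φ 1 = 1 := by
  ext n
  cases n with
  | zero => simp [lagrangeFun]
  | succ n =>
    have h : coeff n (derivative A (Φ ^ (n + 1)))
        = (n + 1 : A) * coeff n (derivative A Φ * Φ ^ n) := by
      rw [Derivation.leibniz_pow]
      simp only [Nat.add_sub_cancel, smul_eq_mul, nsmul_eq_mul, ← coeff_C_mul]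
      congr 1
      push_cast
      simp
      ring
    rw [coeff_derivative, mul_comm] at h
    have hu : IsUnit (n + 1 : A) := by
      have := (isUnit_iff_ne_zero.2 (n.cast_add_one_ne_zero (R := ℚ))).map (algebraMap ℚ A)
      simpa using this
    have := hu.mul_left_cancel h
    simp [lagrangeFun, mul_assoc, coeff_succ_X_mul, this, coeff_one]

/-- Multiplicativity, one coefficient at a time: peeling the factor `X` off `H` trades `H` for
`Φ` times its shift and lowers the index by one. -/
theorem coeff_lagrangeFun_mul [Algebra ℚ A] (Φ K : A⟦X⟧) (n : ℕ) : ∀ H : A⟦X⟧,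
    coeff n (lagrangeFun Φ (H * K)) = coeff n (lagrangeFun Φ H * lagrangeFun Φ K) := by
  induction n with
  | zero =>
    intro H
    simp [lagrangeFun]
  | succ n ih =>
    intro H
    -- Split off the constant term of `H`.
    have hH := eq_X_mul_shift_add_const H
    set G : A⟦X⟧ := PowerSeries.mk fun p => coeff (p + 1) H
    set a := constantCoeff H
    have h1 : lagrangeFun Φ (H * K)
        = X * lagrangeFun Φ (Φ * G * K) + C a * lagrangeFun Φ K := by
      rw [hH, add_mul, lagrangeFun_add, lagrangeFun_C_mul, mul_assoc, lagrangeFun_X_mul, mul_assoc]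
    have h2 : lagrangeFun Φ H = X * lagrangeFun Φ (Φ * G) + C a := by
      conv_lhs => rw [hH]
      rw [lagrangeFun_add, lagrangeFun_X_mul]
      nth_rewrite 1 [← mul_one (C a)]
      rw [lagrangeFun_C_mul, lagrangeFun_one, mul_one]
    rw [h1, h2, add_mul, mul_assoc X, mul_assoc Φ, ← mul_assoc Φ, map_add, map_add,
      coeff_succ_X_mul, coeff_succ_X_mul, ih]

/-- Substitution of the solution `U` of `U = X Φ(U)`, as a ring homomorphism; `U` itself is the
image of `X`. -/
noncomputable def lagrange [Algebra ℚ A] (Φ : A⟦X⟧) : A⟦X⟧ →+* A⟦X⟧ where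
  toFun := lagrangeFun Φ
  map_one' := lagrangeFun_one Φ
  map_mul' H K := PowerSeries.ext fun n => coeff_lagrangeFun_mul Φ K n H
  map_zero' := by ext; simp [lagrangeFun]
  map_add' := lagrangeFun_add Φ

variable [Algebra ℚ A]

theorem lagrange_C (Φ : A⟦X⟧) (a : A) : lagrange Φ (C a) = C a := by
  have := lagrangeFun_C_mul Φ 1 a
  rwa [mul_one, lagrangeFun_one, mul_one] at this

theorem lagrange_X (Φ : A⟦X⟧) : lagrange Φ X = X * lagrange Φ Φ := by
  have := lagrangeFun_X_mul Φ 1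
  rwa [mul_one, mul_one] at this

theorem constantCoeff_lagrange (Φ H : A⟦X⟧) :
    constantCoeff (lagrange Φ H) = constantCoeff H := by
  simp [lagrange, lagrangeFun]

/-- The Lagrange inversion formula `[X ^ n] H(U) = (1 / n) [u ^ (n - 1)] H'(u) Φ(u) ^ n`. -/
theorem coeff_lagrange (Φ H : A⟦X⟧) (n : ℕ) :
    (n + 1 : A) * coeff (n + 1) (lagrange Φ H) = coeff n (derivative A H * Φ ^ (n + 1)) := by
  have h : coeff n (derivative A (H * Φ ^ (n + 1)))
        = (n + 1 : A) * coeff n (H * (derivative A Φ * Φ ^ n))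
          + coeff n (derivative A H * Φ ^ (n + 1)) := by
    rw [Derivation.leibniz, Derivation.leibniz_pow]
    simp only [Nat.add_sub_cancel, smul_eq_mul, nsmul_eq_mul, ← coeff_C_mul, ← map_add]
    congr 1
    push_cast
    simp
    ring
  rw [coeff_derivative] at h
  have h2 : coeff (n + 1) (lagrange Φ H)
      = coeff (n + 1) (H * Φ ^ (n + 1)) - coeff n (H * (derivative A Φ * Φ ^ n)) := by
    rw [← coeff_succ_X_mul n, ← map_sub]
    simp only [lagrange, lagrangeFun, RingHom.coe_mk, MonoidHom.coe_mk, OneHom.coe_mk, coeff_mk,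
      Nat.add_sub_cancel]
    congr 1
    ring
  rw [h2]
  linear_combination h

end Lagrange

/-- The exchange of the two variables of an iterated power series ring. Coefficients of powers of
`1 / (1 - v)` are read off with `Y` as the outer variable, whereas `lagrange` acts on the outer
variable `u`. -/
noncomputable def swapVars (R : Type*) [CommRing R] : R⟦X⟧⟦X⟧ →+* R⟦X⟧⟦X⟧ where
  toFun f := PowerSeries.mk fun d => PowerSeries.mk fun e => coeff d (coeff e f)
  map_one' := by
    ext d e
    simp only [coeff_mk, coeff_one]
    split_ifs <;> simp [coeff_one, *]
  map_mul' f g := by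
    ext d e
    simp only [coeff_mk, coeff_mul, map_sum]
    rw [Finset.sum_comm]
  map_zero' := by ext; simp
  map_add' f g := by ext; simp

theorem coeff_swapVars {R : Type*} [CommRing R] (f : R⟦X⟧⟦X⟧) (d e : ℕ) :
    coeff e (coeff d (swapVars R f)) = coeff d (coeff e f) := by
  simp [swapVars]

theorem swapVars_X {R : Type*} [CommRing R] : swapVars R X = C X := by
  ext d e
  simp only [coeff_swapVars, coeff_X, coeff_C]
  split_ifs <;> simp [coeff_one, coeff_X, *]

theorem swapVars_C_X {R : Type*} [CommRing R] : swapVars R (C X) = X := by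
  ext d e
  simp only [coeff_swapVars, coeff_X, coeff_C]
  split_ifs <;> simp [coeff_one, coeff_X, *]

end PowerSeries

/-! ### The parametrization of the generating function -/

namespace PowerSeries

section Parametrization

variable (R : Type*) [CommRing R]

/-- The series `1 / (1 - u)` in `R⟦Y⟧⟦u⟧`. -/
noncomputable def geomU : R⟦X⟧⟦X⟧ := swapVars R (C (PowerSeries.mk 1))

/-- The series `v = Y / (1 - u) ^ 2` in `R⟦Y⟧⟦u⟧`. -/
noncomputable def auxV : R⟦X⟧⟦X⟧ := C X * geomU R ^ 2

/-- The series `1 / (1 - v) = ∑ Y ^ e / (1 - u) ^ (2 e)` in `R⟦Y⟧⟦u⟧`. -/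
noncomputable def geomV : R⟦X⟧⟦X⟧ :=
  swapVars R (rescale (PowerSeries.mk 1 ^ 2) (PowerSeries.mk 1))

theorem geomU_mul : geomU R * (1 - X) = 1 := by
  rw [geomU, ← swapVars_C_X, ← map_one (swapVars R), ← map_sub, ← map_mul, ← map_one C, ← map_sub,
    ← map_mul, mk_one_mul_one_sub_eq_one]

theorem geomV_mul : geomV R * (1 - auxV R) = 1 := by
  have h := congrArg (swapVars R) (congrArg (rescale ((PowerSeries.mk 1 : R⟦X⟧) ^ 2))
    (mk_one_mul_one_sub_eq_one R⟦X⟧))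
  simp only [map_mul, map_sub, map_one, rescale_X, swapVars_X, map_pow] at h
  rw [geomV, auxV, geomU, mul_comm (C X)]
  exact h

theorem derivative_geomU : derivative R⟦X⟧ (geomU R) = geomU R ^ 2 := by
  have h := congrArg (derivative R⟦X⟧) (geomU_mul R)
  simp only [derivative_mul, derivative_sub, derivative_one, derivative_X] at h
  linear_combination geomU R * h - derivative R⟦X⟧ (geomU R) * geomU_mul R

theorem derivative_auxV : derivative R⟦X⟧ (auxV R) = 2 * auxV R * geomU R := by
  rw [auxV, derivative_mul, derivative_pow, derivative_C, derivative_geomU]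
  push_cast
  ring

theorem derivative_geomV :
    derivative R⟦X⟧ (geomV R) = 2 * auxV R * geomU R * geomV R ^ 2 := by
  have h := congrArg (derivative R⟦X⟧) (geomV_mul R)
  simp only [derivative_mul, derivative_sub, derivative_one, derivative_auxV] at h
  linear_combination geomV R * h - derivative R⟦X⟧ (geomV R) * geomV_mul R

/-- The coefficient of `u ^ d Y ^ e` in `(1 - u) ^ (-a - 1) (1 - v) ^ (-m - 1)`. -/
theorem coeff_geom (a m d e : ℕ) :
    coeff e (coeff d (geomU R ^ (a + 1) * geomV R ^ (m + 1)))
      = ((m + e).choose m * (a + 2 * e + d).choose (a + 2 * e) : ℕ) := by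
  rw [geomU, geomV, ← map_pow (swapVars R), ← map_pow (swapVars R), ← map_mul, coeff_swapVars,
    ← map_pow C, ← map_pow (rescale _), coeff_C_mul, coeff_rescale,
    mk_one_pow_eq_mk_choose_add R⟦X⟧, coeff_mk, ← mul_assoc, ← pow_mul,
    ← pow_add, show a + 1 + 2 * e = a + 2 * e + 1 by ring, mk_one_pow_eq_mk_choose_add,
    ← map_natCast (C (R := R)), coeff_mul_C, coeff_mk]
  push_cast
  ring

theorem coeff_zero_auxV_mul (F : R⟦X⟧⟦X⟧) (d : ℕ) : coeff 0 (coeff d (auxV R * F)) = 0 := by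
  rw [auxV, mul_assoc, coeff_C_mul, coeff_zero_X_mul]

theorem coeff_succ_auxV_mul (F : R⟦X⟧⟦X⟧) (d e : ℕ) :
    coeff (e + 1) (coeff d (auxV R * F)) = coeff e (coeff d (geomU R ^ 2 * F)) := by
  rw [auxV, mul_assoc, coeff_C_mul, coeff_succ_X_mul]

end Parametrization

/-- The series `U` in `ℚ⟦Y⟧⟦X⟧` of the parametrization `X = U (1 - V) ^ 2`,
`Y = V (1 - U) ^ 2`. Eliminating `V` gives `U = X Φ(U)` with
`Φ(u) = (1 - Y / (1 - u) ^ 2) ^ (-2)`, the square of `geomV`. -/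
noncomputable def paramU : ℚ⟦X⟧⟦X⟧ := lagrange (geomV ℚ ^ 2) X

/-- The series `V = Y / (1 - U) ^ 2` of the same parametrization. -/
noncomputable def paramV : ℚ⟦X⟧⟦X⟧ := lagrange (geomV ℚ ^ 2) (auxV ℚ)

/-- The series `(1 - U - V) / ((1 - U) ^ 2 (1 - V) ^ 2)`, which turns out to count the `2`-stack
sortable permutations, `X` marking descents and `Y` ascents. -/
noncomputable def closedSeries : ℚ⟦X⟧⟦X⟧ :=
  lagrange (geomV ℚ ^ 2) ((geomU ℚ - auxV ℚ * geomU ℚ ^ 2) * geomV ℚ ^ 2)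

theorem paramU_mul : paramU * (1 - paramV) ^ 2 = X := by
  have h := congrArg (lagrange (geomV ℚ ^ 2))
    (show geomV ℚ ^ 2 * (1 - auxV ℚ) ^ 2 = 1 by rw [← mul_pow, geomV_mul, one_pow])
  simp only [map_mul, map_pow, map_sub, map_one] at h
  rw [paramU, paramV, lagrange_X, mul_assoc, map_pow, h, mul_one]

theorem paramV_mul : paramV * (1 - paramU) ^ 2 = C X := by
  have h : auxV ℚ * (1 - X) ^ 2 = C X := by
    rw [auxV, mul_assoc, ← mul_pow, geomU_mul, one_pow, mul_one]
  have := congrArg (lagrange (geomV ℚ ^ 2)) h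
  simp only [map_mul, map_pow, map_sub, map_one, lagrange_C] at this
  exact this

theorem closedSeries_mul :
    closedSeries * ((1 - paramU) ^ 2 * (1 - paramV) ^ 2) = 1 - paramU - paramV := by
  have h : (geomU ℚ - auxV ℚ * geomU ℚ ^ 2) * geomV ℚ ^ 2 * ((1 - X) ^ 2 * (1 - auxV ℚ) ^ 2)
      = 1 - X - auxV ℚ := by
    have h1 := geomU_mul ℚ
    have h2 : geomV ℚ ^ 2 * (1 - auxV ℚ) ^ 2 = 1 := by rw [← mul_pow, geomV_mul, one_pow]
    calc _ = ((1 - X) * (geomU ℚ * (1 - X)) - auxV ℚ * (geomU ℚ * (1 - X)) ^ 2)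
          * (geomV ℚ ^ 2 * (1 - auxV ℚ) ^ 2) := by ring
      _ = _ := by rw [h1, h2]; ring
  have := congrArg (lagrange (geomV ℚ ^ 2)) h
  rw [map_mul, ← closedSeries] at this
  simp only [map_mul, map_pow, map_sub, map_one] at this
  exact this

theorem constantCoeff_paramU : constantCoeff paramU = 0 := by
  rw [paramU, constantCoeff_lagrange, constantCoeff_X]

theorem constantCoeff_paramV : constantCoeff paramV = X := by
  have h := congrArg (constantCoeff (R := ℚ⟦X⟧)) paramV_mul
  simpa [constantCoeff_paramU] using h

/-- The arithmetic behind `coeff_closedSeries` for the coefficient `X ^ (d + 1) Y ^ 0`. -/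
theorem binomial_identity_zero (d : ℕ) :
    (((2 * d + 4).choose (2 * d + 4) * (1 + d).choose 1 : ℕ) : ℚ)
      = (d + 1) * ((((2 * d + 3)! * (d + 2)! : ℕ) : ℚ) / (((d + 2)! * 1 ! * (2 * d + 3)! * 1 ! : ℕ) : ℚ)) := by
  rw [Nat.choose_self, Nat.choose_one_right]
  have h1 := Nat.factorial_ne_zero (d + 2)
  have h2 := Nat.factorial_ne_zero (2 * d + 3)
  push_cast
  field_simp
  simp
  ring

/-- The arithmetic behind `coeff_closedSeries` for the coefficient `X ^ (d + 1) Y ^ (e + 1)`. -/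
theorem binomial_identity_succ (d e : ℕ) :
    (((2 * d + 4 + (e + 1)).choose (2 * d + 4) * (1 + 2 * (e + 1) + d).choose (1 + 2 * (e + 1)) : ℕ) : ℚ)
      + 3 * (((2 * d + 4 + e).choose (2 * d + 4) * (3 + 2 * e + d).choose (3 + 2 * e) : ℕ) : ℚ)
      - 4 * (((2 * d + 4 + e).choose (2 * d + 4) * (4 + 2 * e + d).choose (4 + 2 * e) : ℕ) : ℚ)
      = (d + 1) * ((((2 * d + e + 4)! * (d + 2 * e + 4)! : ℕ) : ℚ) /
          (((d + 2)! * (e + 2)! * (2 * d + 3)! * (2 * e + 3)! : ℕ) : ℚ)) := by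
  push_cast
  simp only [Nat.cast_add_choose]
  have e1 : (2 * d + 4 + (e + 1))! = (2 * d + e + 5) * (2 * d + e + 4)! := by
    rw [← Nat.factorial_succ]; congr 1; ring
  have e2 : (1 + 2 * (e + 1) + d)! = (d + 2 * e + 3)! := by congr 1; ring
  have e3 : (3 + 2 * e + d)! = (d + 2 * e + 3)! := by congr 1; ring
  have e4 : (4 + 2 * e + d)! = (d + 2 * e + 4) * (d + 2 * e + 3)! := by
    rw [← Nat.factorial_succ]; congr 1; ring
  have e5 : (d + 2 * e + 4)! = (d + 2 * e + 4) * (d + 2 * e + 3)! := by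
    rw [← Nat.factorial_succ]
  have e6 : (2 * d + 4 + e)! = (2 * d + e + 4)! := by congr 1; ring
  have e7 : (4 + 2 * e)! = (2 * e + 4) * (2 * e + 3)! := by
    rw [← Nat.factorial_succ]; congr 1; ring
  have e8 : (3 + 2 * e)! = (2 * e + 3)! := by congr 1; ring
  have e9 : (1 + 2 * (e + 1))! = (2 * e + 3)! := by congr 1; ring
  have e10 : (2 * d + 4)! = (2 * d + 4) * (2 * d + 3)! := by rw [← Nat.factorial_succ]
  have e11 : (d + 2)! = (d + 2) * ((d + 1) * d !) := by
    rw [← Nat.factorial_succ, ← Nat.factorial_succ]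
  have e12 : (e + 2)! = (e + 2) * ((e + 1) * e !) := by
    rw [← Nat.factorial_succ, ← Nat.factorial_succ]
  rw [e1, e2, e3, e4, e5, e6, e7, e8, e9, e10, e11, e12, Nat.factorial_succ e]
  have h1 := Nat.factorial_ne_zero d
  have h2 := Nat.factorial_ne_zero e
  have h3 := Nat.factorial_ne_zero (2 * d + 3)
  have h4 := Nat.factorial_ne_zero (2 * e + 3)
  push_cast
  field_simp
  ring

theorem coeff_closedSeries (d e : ℕ) :
    coeff e (coeff d closedSeries)
      = (((2 * d + e + 1)! * (d + 2 * e + 1)! : ℕ) : ℚ) /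
          (((d + 1)! * (e + 1)! * (2 * d + 1)! * (2 * e + 1)! : ℕ) : ℚ) := by
  cases d with
  | zero =>
    -- At `X = 0` the series reduces to `1 / (1 - Y)`.
    have h : constantCoeff closedSeries = constantCoeff (geomU ℚ ^ (0 + 1) * geomV ℚ ^ (0 + 1)) := by
      have h1 : constantCoeff (geomU ℚ) = 1 := by
        simpa using congrArg (constantCoeff (R := ℚ⟦X⟧)) (geomU_mul ℚ)
      have h2 : constantCoeff (geomV ℚ) * (1 - constantCoeff (auxV ℚ)) = 1 := by
        simpa only [map_mul, map_sub, map_one] using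
          congrArg (constantCoeff (R := ℚ⟦X⟧)) (geomV_mul ℚ)
      rw [closedSeries, constantCoeff_lagrange]
      simp only [map_mul, map_sub, map_pow, h1]
      linear_combination constantCoeff (geomV ℚ) * h2
    rw [coeff_zero_eq_constantCoeff_apply, h, ← coeff_zero_eq_constantCoeff_apply, coeff_geom]
    have h1 := Nat.factorial_ne_zero (e + 1)
    have h2 := Nat.factorial_ne_zero (2 * e + 1)
    simp
    field_simp
  | succ d =>
    -- The derivative in the Lagrange inversion formula, expanded in `1 / (1 - u)`, `v` and
    -- `1 / (1 - v)`.
    have hD : derivative ℚ⟦X⟧ ((geomU ℚ - auxV ℚ * geomU ℚ ^ 2) * geomV ℚ ^ 2)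
        * (geomV ℚ ^ 2) ^ (d + 1)
        = geomU ℚ ^ (1 + 1) * geomV ℚ ^ (2 * d + 4 + 1)
          + auxV ℚ * (C (C 3) * (geomU ℚ ^ 2 * geomV ℚ ^ (2 * d + 4 + 1)))
          - auxV ℚ * (C (C 4) * (geomU ℚ ^ 3 * geomV ℚ ^ (2 * d + 4 + 1))) := by
      have hd : derivative ℚ⟦X⟧ ((geomU ℚ - auxV ℚ * geomU ℚ ^ 2) * geomV ℚ ^ 2)
          = (geomU ℚ ^ 2 + 3 * auxV ℚ * geomU ℚ ^ 2 - 4 * auxV ℚ * geomU ℚ ^ 3)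
            * geomV ℚ ^ 3 := by
        simp only [derivative_mul, derivative_pow, derivative_sub, derivative_geomU,
          derivative_auxV, derivative_geomV]
        push_cast
        linear_combination (geomU ℚ ^ 2 - 4 * auxV ℚ * geomU ℚ ^ 3) * geomV ℚ ^ 2 * (- geomV_mul ℚ)
      rw [hd]
      simp only [map_ofNat]
      ring
    have hL := coeff_lagrange (geomV ℚ ^ 2) ((geomU ℚ - auxV ℚ * geomU ℚ ^ 2) * geomV ℚ ^ 2) d
    rw [hD, ← closedSeries] at hL
    have hL' := congrArg (coeff e) hL
    have hn : ((d : ℚ⟦X⟧) + 1) = C ((d : ℚ) + 1) := by simp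
    rw [hn, coeff_C_mul] at hL'
    simp only [map_add, map_sub, coeff_geom] at hL'
    have hd0 : ((d : ℚ) + 1) ≠ 0 := by positivity
    apply mul_left_cancel₀ hd0
    rw [hL']
    cases e with
    | zero =>
      simp only [coeff_zero_auxV_mul]
      have := binomial_identity_zero d
      simp only [mul_zero, add_zero, zero_add, sub_zero] at this ⊢
      rw [this]
      ring_nf
    | succ e =>
      simp only [coeff_succ_auxV_mul]
      have h2 : geomU ℚ ^ 2 * (C (C (3 : ℚ)) * (geomU ℚ ^ 2 * geomV ℚ ^ (2 * d + 4 + 1)))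
          = C (C 3) * (geomU ℚ ^ (3 + 1) * geomV ℚ ^ (2 * d + 4 + 1)) := by ring
      have h3 : geomU ℚ ^ 2 * (C (C (4 : ℚ)) * (geomU ℚ ^ 3 * geomV ℚ ^ (2 * d + 4 + 1)))
          = C (C 4) * (geomU ℚ ^ (4 + 1) * geomV ℚ ^ (2 * d + 4 + 1)) := by ring
      rw [h2, h3]
      simp only [coeff_C_mul, coeff_geom]
      rw [binomial_identity_succ]
      congr 5 <;> ring

end PowerSeries

/-! ### Solution of the catalytic equation -/

namespace PowerSeries

/-- A map that is contracting for the `X`-adic distance has a fixed point. -/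
theorem exists_fixedPoint {R : Type*} [CommRing R] (T : R⟦X⟧ → R⟦X⟧)
    (hT : ∀ n f g, X ^ n ∣ f - g → X ^ (n + 1) ∣ T f - T g) : ∃ f, T f = f := by
  have hs : ∀ n, X ^ n ∣ T^[n + 1] 0 - T^[n] 0 := by
    intro n
    induction n with
    | zero => simp
    | succ n ih =>
      rw [Function.iterate_succ_apply' T (n + 1)]
      nth_rewrite 2 [Function.iterate_succ_apply']
      exact hT n _ _ ih
  have hle : ∀ m n, m ≤ n → X ^ m ∣ T^[n] 0 - T^[m] 0 := by
    intro m n h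
    induction n, h using Nat.le_induction with
    | base => simp
    | succ n hmn ih =>
      have := dvd_add ((pow_dvd_pow X hmn).trans (hs n)) ih
      rwa [sub_add_sub_cancel] at this
  set f : R⟦X⟧ := PowerSeries.mk fun n => coeff n (T^[n + 1] 0) with hf
  have hfn : ∀ n, X ^ n ∣ f - T^[n] 0 := by
    intro n
    rw [X_pow_dvd_iff]
    intro m hm
    have := X_pow_dvd_iff.1 (hle (m + 1) n hm) m (Nat.lt_succ_self m)
    rw [map_sub] at this ⊢
    rw [hf, coeff_mk]
    linear_combination -this
  refine ⟨f, ?_⟩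
  ext n
  have h1 := hT n _ _ (hfn n)
  rw [← Function.iterate_succ_apply' T] at h1
  have h2 := dvd_sub h1 (hfn (n + 1))
  rw [sub_sub_sub_cancel_right] at h2
  have := X_pow_dvd_iff.1 h2 n (Nat.lt_succ_self n)
  rwa [map_sub, sub_eq_zero] at this

/-- The inclusion of `ℚ⟦Y⟧⟦X⟧` into `ℚ⟦z⟧⟦Y⟧⟦X⟧`. -/
noncomputable def inclConst : ℚ⟦X⟧⟦X⟧ →+* ℚ⟦X⟧⟦X⟧⟦X⟧ := map (map C)

/-- The evaluation at `z = 0`. -/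
noncomputable def evalZero : ℚ⟦X⟧⟦X⟧⟦X⟧ →+* ℚ⟦X⟧⟦X⟧ := map (map constantCoeff)

theorem evalZero_inclConst (f : ℚ⟦X⟧⟦X⟧) : evalZero (inclConst f) = f := by
  ext d e
  simp [evalZero, inclConst]

theorem constantCoeff_inclConst (f : ℚ⟦X⟧⟦X⟧) :
    constantCoeff (inclConst f) = map C (constantCoeff f) := by
  simp only [← coeff_zero_eq_constantCoeff_apply, inclConst, coeff_map]

/-- The functional equation `z F = v (z (1 + (X + Y) F) + X Y F (v F - F₁))` in `ℚ⟦z⟧⟦Y⟧⟦X⟧`, where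
`F₁` is `F` at `z = 0`. The catalytic variable is `v = 1 + z`, so that the evaluation at `v = 1` is
the constant coefficient in `z`. -/
def CatalyticEq (F : ℚ⟦X⟧⟦X⟧⟦X⟧) : Prop :=
  C (C X) * F = (1 + C (C X)) * (C (C X) * (1 + (X + C X) * F)
    + X * C X * F * ((1 + C (C X)) * F - inclConst (evalZero F)))

/-- Modulo the next power of `X`, the equation for the difference of two solutions of the same
lower order reads `z (1 - v Y) (F - G) = 0`. -/
theorem CatalyticEq.unique {F G : ℚ⟦X⟧⟦X⟧⟦X⟧} (hF : CatalyticEq F) (hG : CatalyticEq G) :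
    F = G := by
  unfold CatalyticEq at hF hG
  have key : C (C X * (1 - (1 + C X) * X)) * (F - G)
      = X * ((1 + C (C X)) * (C (C X) * (F - G) + C X * ((1 + C (C X)) * (F + G) * (F - G)
          - F * inclConst (evalZero (F - G)) - inclConst (evalZero G) * (F - G)))) := by
    simp only [map_mul, map_sub, map_add, map_one]
    linear_combination hF - hG
  have hdvd : ∀ n, X ^ n ∣ F - G := by
    intro n
    induction n with
    | zero => simp
    | succ n ih =>
      have h1 : X ^ n ∣ inclConst (evalZero (F - G)) := by
        obtain ⟨q, hq⟩ := ih
        refine ⟨inclConst (evalZero q), ?_⟩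
        rw [hq, map_mul, map_mul, map_pow, map_pow]
        simp [inclConst, evalZero]
      have h2 : X ^ (n + 1) ∣ C (C X * (1 - (1 + C X) * X)) * (F - G) := by
        rw [key, pow_succ']
        refine mul_dvd_mul_left X (Dvd.dvd.mul_left (dvd_add (ih.mul_left _) (Dvd.dvd.mul_left
          (dvd_sub (dvd_sub (ih.mul_left _) (h1.mul_left _)) (ih.mul_left _)) _)) _)
      rw [X_pow_dvd_iff] at h2 ih ⊢
      intro m hm
      rcases Nat.lt_succ_iff_lt_or_eq.1 hm with h | rfl
      · exact ih m h
      · have := h2 m hm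
        rw [coeff_C_mul] at this
        refine (mul_eq_zero.1 this).resolve_left (mul_ne_zero ?_ ?_)
        · intro h
          exact X_ne_zero (C_injective (h.trans (map_zero C).symm))
        · intro h
          simpa using congrArg (constantCoeff (R := ℚ⟦X⟧)) h
  ext1 n
  have := X_pow_dvd_iff.1 (hdvd (n + 1)) n (Nat.lt_succ_self n)
  rwa [map_sub, sub_eq_zero] at this

/-- The series that uniformizes the equation for `F`: it makes the discriminant of that quadratic
equation a square. After division by `1 - v V (1 - U)` the equation is a contraction, since `U` is
divisible by `X`. -/
theorem exists_kernelSeries : ∃ W : ℚ⟦X⟧⟦X⟧⟦X⟧,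
    W = (1 + C (C X)) * (1 + inclConst (paramU * (1 - paramV)) * W)
      * (1 + inclConst (paramV * (1 - paramU)) * W) := by
  set A := inclConst (paramU * (1 - paramV)) with hA
  set B := inclConst (paramV * (1 - paramU)) with hB
  have hXA : X ∣ A := by
    rw [X_dvd_iff]
    have : constantCoeff (paramU * (1 - paramV)) = 0 := by
      rw [map_mul, constantCoeff_paramU, zero_mul]
    rw [hA, constantCoeff_inclConst, this, map_zero]
  have hunit : IsUnit (1 - (1 + C (C X)) * B) := by
    rw [isUnit_iff_constantCoeff, isUnit_iff_constantCoeff]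
    have : constantCoeff (paramV * (1 - paramU)) = X := by
      rw [map_mul, map_sub, map_one, constantCoeff_paramU, constantCoeff_paramV, sub_zero, mul_one]
    rw [map_sub, map_mul, hB, constantCoeff_inclConst, this]
    simp
  obtain ⟨u, hu⟩ := hunit.exists_right_inv
  obtain ⟨W, hW⟩ := exists_fixedPoint
    (fun W => u * ((1 + C (C X)) * (1 + A * W + A * B * W ^ 2))) (by
      intro n f g h
      have : u * ((1 + C (C X)) * (1 + A * f + A * B * f ^ 2))
          - u * ((1 + C (C X)) * (1 + A * g + A * B * g ^ 2))
          = A * (f - g) * (u * (1 + C (C X)) * (1 + B * (f + g))) := by ring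
      rw [this, pow_succ']
      exact (mul_dvd_mul hXA h).mul_right _)
  refine ⟨W, ?_⟩
  linear_combination (1 - (1 + C (C X)) * B) * (-hW)
    - ((1 + C (C X)) * (1 + A * W + A * B * W ^ 2)) * (-hu)

/-- The unique solution of the functional equation is `F = W - U V W ^ 2`, where `W` is the series of
`exists_kernelSeries`. -/
theorem evalZero_eq_closedSeries {F : ℚ⟦X⟧⟦X⟧⟦X⟧} (hF : CatalyticEq F) :
    evalZero F = closedSeries := by
  obtain ⟨W, hW⟩ := exists_kernelSeries
  set U := inclConst paramU with hU
  set V := inclConst paramV with hV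
  set z : ℚ⟦X⟧⟦X⟧⟦X⟧ := C (C X) with hz
  have hX : U * (1 - V) ^ 2 = X := by
    have := congrArg inclConst paramU_mul
    simp only [map_mul, map_pow, map_sub, map_one] at this
    rw [this, inclConst, map_X]
  have hY : V * (1 - U) ^ 2 = C X := by
    have := congrArg inclConst paramV_mul
    simp only [map_mul, map_pow, map_sub, map_one] at this
    rw [this, inclConst, map_C, map_X]
  have hS : X * C X * inclConst closedSeries = U * V * (1 - U - V) := by
    have := congrArg inclConst closedSeries_mul
    simp only [map_mul, map_pow, map_sub, map_one, ← hU, ← hV] at this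
    rw [← hX, ← hY]
    linear_combination U * V * this
  simp only [map_mul, map_sub, map_one, ← hU, ← hV] at hW
  set G := W - U * V * W ^ 2 with hG
  have h1 : z * G = (1 + z) * (z * (1 + (X + C X) * G)
      + X * C X * G * ((1 + z) * G - inclConst closedSeries)) := by
    have : z * G = (1 + z) * (z * (1 + (X + C X) * G)
      + X * C X * (1 + z) * G ^ 2 - (U * V * (1 - U - V)) * G) := by
      rw [← hX, ← hY, hG]
      linear_combination ((1 + z) * (1 - U) * (1 - V) * U ^ 2 * V ^ 2 * W ^ 2
        + U * V * ((1 + z) * (U + V - 2) + 1) * W + z) * hW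
    rw [this]
    linear_combination (1 + z) * G * hS
  -- At `z = 0` the equation becomes `X Y G₁ (G₁ - closedSeries) = 0` in an integral domain.
  have h2 : evalZero G = closedSeries := by
    have h := congrArg evalZero h1
    have hz0 : evalZero z = 0 := by simp [hz, evalZero]
    have hX0 : evalZero X = X := by simp [evalZero]
    have hY0 : evalZero (C X) = C X := by simp [evalZero]
    simp only [map_mul, map_add, map_sub, map_one, hz0, hX0, hY0, evalZero_inclConst, zero_mul,
      add_zero, one_mul, zero_add] at h
    have hne : evalZero G ≠ 0 := by
      intro h0
      have hU0 : constantCoeff (evalZero U) = 0 := by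
        rw [hU, evalZero_inclConst, constantCoeff_paramU]
      have hW0 := congrArg (constantCoeff (R := ℚ)) (congrArg (constantCoeff (R := ℚ⟦X⟧))
        (congrArg evalZero hW))
      have hV0 : constantCoeff (evalZero V) = X := by
        rw [hV, evalZero_inclConst, constantCoeff_paramV]
      have hG0 := congrArg (constantCoeff (R := ℚ)) (congrArg (constantCoeff (R := ℚ⟦X⟧)) h0)
      rw [hG] at hG0
      simp only [map_mul, map_add, map_sub, map_one, map_pow, hU0, hV0, hz0, map_zero,
        constantCoeff_X, zero_mul, add_zero, sub_zero, mul_one] at hW0 hG0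
      exact one_ne_zero (hW0.symm.trans hG0)
    have hCX : (C X : ℚ⟦X⟧⟦X⟧) ≠ 0 := fun h =>
      X_ne_zero (C_injective (h.trans (map_zero C).symm))
    have := (mul_eq_zero.1 h.symm).resolve_left (mul_ne_zero (mul_ne_zero X_ne_zero hCX) hne)
    exact sub_eq_zero.1 this
  have h3 : CatalyticEq G := by
    unfold CatalyticEq
    rw [h2]
    exact h1
  rw [hF.unique h3, h2]

end PowerSeries

/-! ### The stack sorting operation -/

section StackSort

variable {α β : Type*} [LinearOrder α] [LinearOrder β]

/-- A letter larger than everything before it empties the stack. -/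
theorem stackRun_append_cons (l r : List α) (m : α) : ∀ st : List α, (∀ x ∈ l, x < m) →
    (∀ x ∈ st, x < m) → stackRun (l ++ m :: r) st = stackRun l st ++ stackRun r [m] := by
  induction l with
  | nil =>
    intro st _ hst
    have h : ∀ x ∈ st, decide (¬ m < x) = true := fun x hx => by simpa using (hst x hx).le
    simp only [List.nil_append, stackRun]
    rw [List.takeWhile_eq_self_iff.2 h, List.dropWhile_eq_nil_iff.2 h]
  | cons x l ih =>
    intro st hl hst
    simp only [List.cons_append, stackRun, List.append_assoc]
    rw [ih]
    · exact fun y hy => hl y (List.mem_cons_of_mem _ hy)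
    · intro y hy
      rcases List.mem_cons.1 hy with rfl | hy
      · exact hl y List.mem_cons_self
      · exact hst y ((List.dropWhile_sublist _).subset hy)

/-- A letter at the bottom of the stack that is larger than the whole input leaves last. -/
theorem stackRun_append_singleton (l : List α) (m : α) : ∀ st : List α, (∀ x ∈ l, x < m) →
    stackRun l (st ++ [m]) = stackRun l st ++ [m] := by
  induction l with
  | nil => intro st _; rfl
  | cons x l ih =>
    intro st hl
    have hx : x < m := hl x List.mem_cons_self
    have h1 : (st ++ [m]).takeWhile (fun r => decide (¬ x < r))
        = st.takeWhile (fun r => decide (¬ x < r)) := by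
      rw [List.takeWhile_append]
      split_ifs with h
      · rw [(List.takeWhile_prefix _).eq_of_length h]
        simp [hx]
      · rfl
    have h2 : (st ++ [m]).dropWhile (fun r => decide (¬ x < r))
        = st.dropWhile (fun r => decide (¬ x < r)) ++ [m] := by
      rw [List.dropWhile_append]
      split_ifs with h
      · rw [List.isEmpty_iff.1 h]
        simp [hx]
      · rfl
    simp only [stackRun]
    rw [h1, h2, ← List.cons_append, ih _ fun y hy => hl y (List.mem_cons_of_mem _ hy),
      List.append_assoc]

theorem stackSort_append_cons {l r : List α} {m : α} (hl : ∀ x ∈ l, x < m)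
    (hr : ∀ x ∈ r, x < m) : stackSort (l ++ m :: r) = stackSort l ++ stackSort r ++ [m] := by
  unfold stackSort
  rw [stackRun_append_cons l r m [] hl (by simp), List.append_assoc]
  congr 1
  exact stackRun_append_singleton r m [] hr

theorem stackRun_perm (l : List α) : ∀ st : List α, (stackRun l st).Perm (l ++ st) := by
  induction l with
  | nil => intro st; exact List.Perm.refl _
  | cons x l ih =>
    intro st
    simp only [stackRun]
    refine (List.Perm.append_left _ (ih _)).trans ?_
    refine List.perm_iff_count.2 fun a => ?_
    have := congrArg (List.count a)
      (List.takeWhile_append_dropWhile (p := fun r => decide (¬ x < r)) (l := st))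
    simp only [List.count_append, List.count_cons] at this ⊢
    omega

theorem stackSort_perm (l : List α) : (stackSort l).Perm l := by
  simpa [stackSort] using stackRun_perm l []

theorem stackRun_map {f : α → β} (hf : StrictMono f) (l : List α) : ∀ st : List α,
    stackRun (l.map f) (st.map f) = (stackRun l st).map f := by
  induction l with
  | nil => intro st; rfl
  | cons x l ih =>
    intro st
    have h : (fun r => decide (¬ f x < r)) ∘ f = fun r => decide (¬ x < r) := by
      funext r
      simp [hf.le_iff_le]
    simp only [List.map_cons, stackRun, List.takeWhile_map, List.dropWhile_map, List.map_append, h]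
    rw [← List.map_cons, ih]

theorem stackSort_map {f : α → β} (hf : StrictMono f) (l : List α) :
    stackSort (l.map f) = (stackSort l).map f :=
  stackRun_map hf l []

theorem stackSort_length (l : List α) : (stackSort l).length = l.length :=
  (stackSort_perm l).length_eq

theorem mem_stackSort {l : List α} {x : α} : x ∈ stackSort l ↔ x ∈ l :=
  (stackSort_perm l).mem_iff

end StackSort

/-- The number of descents of a word: positions where a letter is followed by a smaller one. -/
def descents {α : Type*} [LinearOrder α] : List α → ℕ
  | [] => 0
  | [_] => 0
  | a :: b :: l => (if b < a then 1 else 0) + descents (b :: l)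

section Descents

variable {α β : Type*} [LinearOrder α] [LinearOrder β]

theorem descents_map {f : α → β} (hf : StrictMono f) (l : List α) :
    descents (l.map f) = descents l := by
  induction l with
  | nil => rfl
  | cons a l ih =>
    cases l with
    | nil => rfl
    | cons b l =>
      simp only [List.map_cons, descents, hf.lt_iff_lt] at ih ⊢
      rw [ih]

theorem descents_lt_length {l : List α} (hl : l ≠ []) : descents l < l.length := by
  induction l with
  | nil => exact absurd rfl hl
  | cons a l ih =>
    cases l with
    | nil => simp [descents]
    | cons b l =>
      have := ih (by simp)
      simp only [descents, List.length_cons] at this ⊢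
      split_ifs <;> omega

theorem descents_append_cons {m : α} (r : List α) : ∀ l : List α, (∀ x ∈ l, x < m) →
    descents (l ++ m :: r) = descents l + descents (m :: r)
  | [], _ => by simp [descents]
  | [a], h => by simp [descents, (h a (by simp)).le]
  | a :: b :: l, h => by
    have := descents_append_cons r (b :: l) fun x hx => h x (List.mem_cons_of_mem _ hx)
    simp only [List.cons_append, descents] at this ⊢
    rw [this, add_assoc]

theorem descents_cons_of_forall_lt {m : α} {r : List α} (hr : r ≠ []) (h : ∀ x ∈ r, x < m) :
    descents (m :: r) = descents r + 1 := by
  cases r with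
  | nil => exact absurd rfl hr
  | cons b r => simp [descents, h b (by simp), add_comm]

end Descents

/-! ### Encoding two-stack sortable words -/

/-- `j` is a cut of the word `q` if the first `j` letters of `q` are all less than `j`. For
`j ≤ n` and a permutation `q` of `{0, …, n - 1}`, this says that `q` maps the first `j` positions
to the `j` smallest values. -/
def IsCut (q : List ℕ) (j : ℕ) : Prop := ∀ x ∈ q.take j, x < j

noncomputable instance (q : List ℕ) : DecidablePred (IsCut q) := fun _ => Classical.dec _

/-- The number of components of the image of `l` under the stack: the cuts less than the length.
For the empty word it is `0`, so that the number of cuts up to and including the length is always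
one more. -/
noncomputable def numComponents (l : List ℕ) : ℕ := Nat.count (IsCut (stackSort l)) l.length

/-- The increasing map that fixes the values less than `a` and sends `a` to `a + j`. -/
def shiftTop (a j i : ℕ) : ℕ := if i < a then i else i + j

/-- The increasing bijection from `ℕ` to the values at least `a` and different from `a + j`. -/
def skipAt (a j i : ℕ) : ℕ := if i < j then a + i else a + i + 1

theorem shiftTop_strictMono (a j : ℕ) : StrictMono (shiftTop a j) := by
  intro x y h
  unfold shiftTop
  split_ifs <;> omega

theorem skipAt_strictMono (a j : ℕ) : StrictMono (skipAt a j) := by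
  intro x y h
  unfold skipAt
  split_ifs <;> omega

/-- The word `L n R` with largest letter `n` in which `L` and `R` are order isomorphic to `l` and
`r`, and the letters of `L` other than its maximum are smaller than all letters of `R`, while the
maximum of `L` exceeds exactly `j` letters of `R`. -/
def glue (l r : List ℕ) (j : ℕ) : List ℕ :=
  l.map (shiftTop (l.length - 1) j) ++ (l.length + r.length) ::
    r.map (skipAt (l.length - 1) j)

/-- Words with `d` descents and `e` ascents, paired with a candidate for `numComponents`, obtained
recursively from the decomposition `L n R` at the largest letter. By `mem_codes`, all `2`-stack
sortable words occur. In the last summand `j` numbers the cuts of the image of `R`. -/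
noncomputable def codes : ℕ → ℕ → Multiset (List ℕ × ℕ)
  | 0, 0 => {([0], 1)}
  | 0, e + 1 => (codes 0 e).map fun s => (s.1 ++ [s.1.length], s.2 + 1)
  | d + 1, 0 => (codes d 0).map fun t => (t.1.length :: t.1, t.2 + 1)
  | d + 1, e + 1 =>
    (codes (d + 1) e).map (fun s => (s.1 ++ [s.1.length], s.2 + 1)) +
    (codes d (e + 1)).map (fun t => (t.1.length :: t.1, t.2 + 1)) +
    ∑ a : Fin (d + 1), ∑ b : Fin (e + 1), (codes a b).bind fun s => (codes (d - a) (e - b)).bind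
      fun t => (Multiset.range (t.2 + 1)).map fun j =>
        (glue s.1 t.1 (Nat.nth (IsCut (stackSort t.1)) j), s.2 + (t.2 - j) + 1)
  termination_by d e => d + e

theorem cons_mem_codes {d e : ℕ} {t : List ℕ × ℕ} (h : t ∈ codes d e) :
    (t.1.length :: t.1, t.2 + 1) ∈ codes (d + 1) e := by
  have h' := Multiset.mem_map_of_mem (fun t => (t.1.length :: t.1, t.2 + 1)) h
  cases e with
  | zero => rwa [codes]
  | succ e =>
    rw [codes]
    exact Multiset.mem_add.2 (.inl (Multiset.mem_add.2 (.inr h')))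

theorem append_mem_codes {d e : ℕ} {s : List ℕ × ℕ} (h : s ∈ codes d e) :
    (s.1 ++ [s.1.length], s.2 + 1) ∈ codes d (e + 1) := by
  have h' := Multiset.mem_map_of_mem (fun s => (s.1 ++ [s.1.length], s.2 + 1)) h
  cases d with
  | zero => rwa [codes]
  | succ d =>
    rw [codes]
    exact Multiset.mem_add.2 (.inl (Multiset.mem_add.2 (.inl h')))

theorem glue_mem_codes {a b d e : ℕ} {s t : List ℕ × ℕ} (hs : s ∈ codes a b) (ht : t ∈ codes d e)
    {j : ℕ} (hj : j ≤ t.2) :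
    (glue s.1 t.1 (Nat.nth (IsCut (stackSort t.1)) j), s.2 + (t.2 - j) + 1)
      ∈ codes (a + d + 1) (b + e + 1) := by
  rw [codes]
  refine Multiset.mem_add.2 (.inr ?_)
  rw [Multiset.mem_sum]
  refine ⟨⟨a, by omega⟩, Finset.mem_univ _, ?_⟩
  rw [Multiset.mem_sum]
  refine ⟨⟨b, by omega⟩, Finset.mem_univ _, ?_⟩
  rw [Multiset.mem_bind]
  refine ⟨s, hs, ?_⟩
  rw [Multiset.mem_bind]
  refine ⟨t, by simpa using ht, ?_⟩
  exact Multiset.mem_map.2 ⟨j, Multiset.mem_range.2 (by omega), rfl⟩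

theorem isCut_length {r : List ℕ} {b : ℕ} (hr : r.Perm (List.range b)) :
    IsCut (stackSort r) b := fun _ hx =>
  List.mem_range.1 (hr.subset (mem_stackSort.1 (List.mem_of_mem_take hx)))

theorem count_congr_of_lt {p q : ℕ → Prop} [DecidablePred p] [DecidablePred q] {n : ℕ}
    (h : ∀ i < n, p i ↔ q i) : Nat.count p n = Nat.count q n := by
  induction n with
  | zero => simp
  | succ n ih =>
    rw [Nat.count_succ, Nat.count_succ, ih fun i hi => h i (by omega)]
    simp only [h n (Nat.lt_succ_self n)]

theorem numComponents_append {l : List ℕ} {n : ℕ} (hl : l.Perm (List.range n)) :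
    numComponents (l ++ [n]) = numComponents l + 1 := by
  have hlen : l.length = n := by simpa using hl.length_eq
  have hlt : ∀ x ∈ l, x < n := fun x hx => List.mem_range.1 (hl.subset hx)
  have hs : stackSort (l ++ [n]) = stackSort l ++ [n] := by
    rw [stackSort_append_cons hlt (by simp)]
    simp [stackSort, stackRun]
  have hcut : ∀ i ≤ n, IsCut (stackSort l ++ [n]) i ↔ IsCut (stackSort l) i := by
    intro i hi
    unfold IsCut
    rw [List.take_append_of_le_length (by rw [stackSort_length]; omega)]
  unfold numComponents
  rw [hs, List.length_append, List.length_singleton, hlen, Nat.count_succ,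
    count_congr_of_lt fun i hi => hcut i hi.le, if_pos ((hcut n le_rfl).2 (isCut_length hl))]

theorem numComponents_cons {l : List ℕ} {n : ℕ} (hl : l.Perm (List.range n)) :
    numComponents (n :: l) = numComponents l + 1 := by
  rw [← numComponents_append hl]
  have hlt : ∀ x ∈ l, x < n := fun x hx => List.mem_range.1 (hl.subset hx)
  have h1 := stackSort_append_cons (l := []) (by simp) hlt
  have h2 := stackSort_append_cons (r := []) hlt (by simp)
  have h0 : stackSort ([] : List ℕ) = [] := rfl
  rw [h0] at h1 h2
  rw [List.append_nil] at h2
  simp only [List.nil_append] at h1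
  unfold numComponents
  rw [h1, h2]
  simp

/-- Gluing at the value `j` destroys the cuts of the image of `r` that are less than `j`. -/
theorem numComponents_glue {l r : List ℕ} {a b j : ℕ} (hl : l.Perm (List.range (a + 1)))
    (hr : r.Perm (List.range b)) (hj : j ≤ b) :
    numComponents (glue l r j)
      = numComponents l + (numComponents r - Nat.count (IsCut (stackSort r)) j) + 1 := by
  have hll : l.length = a + 1 := by simpa using hl.length_eq
  have hrl : r.length = b := by simpa using hr.length_eq
  have hlt : ∀ x ∈ l, x < a + 1 := fun x hx => List.mem_range.1 (hl.subset hx)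
  have hrt : ∀ x ∈ r, x < b := fun x hx => List.mem_range.1 (hr.subset hx)
  have hs : stackSort (glue l r j) = (stackSort l).map (shiftTop a j)
      ++ ((stackSort r).map (skipAt a j) ++ [a + 1 + b]) := by
    rw [glue, hll, hrl, Nat.add_sub_cancel, stackSort_append_cons,
      stackSort_map (shiftTop_strictMono a j), stackSort_map (skipAt_strictMono a j),
      List.append_assoc]
    · intro x hx
      obtain ⟨y, hy, rfl⟩ := List.mem_map.1 hx
      have := hlt y hy
      unfold shiftTop
      split_ifs <;> omega
    · intro x hx
      obtain ⟨y, hy, rfl⟩ := List.mem_map.1 hx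
      have := hrt y hy
      unfold skipAt
      split_ifs <;> omega
  have hlow : ∀ i < a + 1, IsCut (stackSort (glue l r j)) i ↔ IsCut (stackSort l) i := by
    intro i hi
    unfold IsCut
    rw [hs, List.take_append_of_le_length (by rw [List.length_map, stackSort_length]; omega),
      ← List.map_take, List.forall_mem_map]
    refine forall₂_congr fun x _ => ?_
    unfold shiftTop
    split_ifs <;> omega
  have hhigh : ∀ i < b + 1, IsCut (stackSort (glue l r j)) (a + 1 + i)
      ↔ j ≤ i ∧ IsCut (stackSort r) i := by
    intro i hi
    have hlen : ((stackSort l).map (shiftTop a j)).length = a + 1 := by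
      rw [List.length_map, stackSort_length, hll]
    unfold IsCut
    rw [hs, ← hlen, List.take_length_add_append, hlen,
      List.take_append_of_le_length (by rw [List.length_map, stackSort_length]; omega),
      ← List.map_take]
    simp only [List.mem_append, or_imp, forall_and, List.forall_mem_map]
    have h1 : (∀ x ∈ stackSort l, shiftTop a j x < a + 1 + i) ↔ j ≤ i := by
      constructor
      · intro h
        have := h a (mem_stackSort.2 (hl.mem_iff.2 (by simp)))
        simp only [shiftTop, lt_irrefl, if_false] at this
        omega
      · intro h x hx
        have := hlt x (mem_stackSort.1 hx)
        unfold shiftTop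
        split_ifs <;> omega
    rw [h1]
    refine and_congr_right fun hji => forall₂_congr fun x _ => ?_
    unfold skipAt
    split_ifs <;> omega
  have hcount : Nat.count (fun i => j ≤ i ∧ IsCut (stackSort r) i) (b + 1)
      = Nat.count (IsCut (stackSort r)) (b + 1) - Nat.count (IsCut (stackSort r)) j := by
    obtain ⟨k, hk⟩ := Nat.exists_eq_add_of_le (hj.trans (Nat.le_succ b))
    have hk' : b + 1 = j + k := hk
    have h0 : Nat.count (fun i => j ≤ i ∧ IsCut (stackSort r) i) j = 0 := by
      rw [count_congr_of_lt (q := fun _ => False) fun i hi => by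
        simp only [iff_false, not_and]; omega]
      simp
    rw [hk', Nat.count_add, Nat.count_add, h0]
    simp
  have hmono : Nat.count (IsCut (stackSort r)) j ≤ Nat.count (IsCut (stackSort r)) b :=
    Nat.count_monotone _ hj
  have hglen : (glue l r j).length = a + 1 + (b + 1) := by
    simp [glue, hll, hrl]
  unfold numComponents
  rw [hglen, Nat.count_add, count_congr_of_lt hlow, count_congr_of_lt hhigh, hcount, hll, hrl,
    Nat.count_succ _ b, if_pos (isCut_length hr)]
  omega

theorem perm_range_of_nodup {l : List ℕ} {n : ℕ} (hl : l.Nodup) (hlt : ∀ x ∈ l, x < n)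
    (hlen : l.length = n) : l.Perm (List.range n) :=
  (List.subperm_of_subset hl fun x hx => List.mem_range.2 (hlt x hx)).perm_of_length_le
    (by simp [hlen])

theorem exists_max_split {α : Type*} [LinearOrder α] {l : List α} (hl : l ≠ []) (hn : l.Nodup) :
    ∃ m l₁ l₂, l = l₁ ++ m :: l₂ ∧ (∀ x ∈ l₁, x < m) ∧ ∀ x ∈ l₂, x < m := by
  have hf : l.toFinset.Nonempty := by
    obtain ⟨x, hx⟩ := List.exists_mem_of_ne_nil l hl
    exact ⟨x, List.mem_toFinset.2 hx⟩
  obtain ⟨m, hm, hmax⟩ := l.toFinset.exists_max_image id hf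
  obtain ⟨l₁, l₂, rfl⟩ := List.mem_iff_append.1 (List.mem_toFinset.1 hm)
  have hn' := List.nodup_middle.1 hn
  rw [List.nodup_cons, List.mem_append, not_or] at hn'
  refine ⟨m, l₁, l₂, rfl, fun x hx => ?_, fun x hx => ?_⟩
  · exact lt_of_le_of_ne (hmax x (by simp [hx])) fun h => hn'.1.1 (h ▸ hx)
  · exact lt_of_le_of_ne (hmax x (by simp [hx])) fun h => hn'.1.2 (h ▸ hx)

/-- If the stack initially holds the letter `m`, then `m` leaves when the first larger letter of the
input is read; `b₁` is the part of the input before that moment. -/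
theorem stackRun_singleton_split {α : Type*} [LinearOrder α] {m : α} {b : List α} (hm : m ∉ b) :
    ∃ b₁ b₂ c : List α, b = b₁ ++ b₂ ∧ c.Perm b₂ ∧ stackRun b [m] = stackSort b₁ ++ m :: c ∧
      stackSort b = stackSort b₁ ++ c := by
  have hb₁ : ∀ x ∈ b.takeWhile (· < m), x < m := fun x hx => by
    simpa using List.mem_takeWhile_imp hx
  have hb := List.takeWhile_append_dropWhile (p := (· < m)) (l := b)
  have hhead : ∀ c b₃, b.dropWhile (· < m) = c :: b₃ → m < c := by
    intro c b₃ h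
    have h1 := List.head?_dropWhile_not (· < m) b
    rw [h] at h1
    have h2 : c ∈ b := (List.dropWhile_sublist _).subset (h ▸ List.mem_cons_self)
    refine lt_of_le_of_ne (by simpa using h1) fun h3 => hm (h3 ▸ h2)
  refine ⟨b.takeWhile (· < m), b.dropWhile (· < m), ?_⟩
  generalize b.takeWhile (· < m) = b₁ at *
  generalize b.dropWhile (· < m) = b₂ at *
  subst hb
  cases b₂ with
  | nil =>
    refine ⟨[], rfl, List.Perm.refl _, ?_, by simp⟩
    rw [List.append_nil]
    exact stackRun_append_singleton b₁ m [] hb₁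
  | cons c b₃ =>
    have hc := hhead c b₃ rfl
    refine ⟨stackRun b₃ [c], rfl, ?_, ?_, ?_⟩
    · exact (stackRun_perm b₃ [c]).trans (List.perm_append_singleton c b₃)
    · rw [stackRun_append_cons b₁ b₃ c [m] (fun x hx => (hb₁ x hx).trans hc) (by simpa using hc)]
      have := stackRun_append_singleton b₁ m [] hb₁
      rw [List.nil_append] at this
      rw [this, List.append_assoc]
      rfl
    · unfold stackSort
      rw [stackRun_append_cons b₁ b₃ c [] (fun x hx => (hb₁ x hx).trans hc) (by simp)]

/-- The decomposition of a `2`-stack sortable word at its largest letter `n`. Let `m` be the maximum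
of `L`. Reading `m` in the second pass empties the stack of the other letters of `L`, so these are
smaller than all of `R`; and the letters of the image of `R` less than `m` come before those greater
than `m`, so `m` is inserted at a cut. -/
theorem exists_glue {L R : List ℕ} {n : ℕ} (hL : L ≠ []) (hp : (L ++ n :: R).Perm (List.range (n + 1)))
    (hs : (stackSort (stackSort (L ++ n :: R))).Pairwise (· < ·)) :
    ∃ (a : ℕ) (l r : List ℕ) (j : ℕ), L = l.map (shiftTop a j) ∧ R = r.map (skipAt a j) ∧
      l.Perm (List.range (a + 1)) ∧ r.Perm (List.range r.length) ∧
      (stackSort (stackSort l)).Pairwise (· < ·) ∧ (stackSort (stackSort r)).Pairwise (· < ·) ∧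
      j ≤ r.length ∧ IsCut (stackSort r) j := by
  have hnd : (L ++ n :: R).Nodup := hp.nodup_iff.2 List.nodup_range
  have hnd' := List.nodup_middle.1 hnd
  have hlen : L.length + R.length = n := by
    have := hp.length_eq
    simp at this
    omega
  have hmem : ∀ x ∈ L ++ R, x < n := by
    intro x hx
    have h1 : x ∈ L ++ n :: R := by
      simp only [List.mem_append, List.mem_cons] at hx ⊢
      tauto
    have h2 := List.mem_range.1 (hp.subset h1)
    have h3 : x ≠ n := fun h => (List.nodup_cons.1 hnd').1 (h ▸ hx)
    omega
  have hLR : (L ++ R).Nodup := (List.nodup_cons.1 hnd').2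
  have hLn := hLR.of_append_left
  have hRn := hLR.of_append_right
  have hLRp : (L ++ R).Perm (List.range n) :=
    perm_range_of_nodup hLR hmem (by simpa using hlen)
  have hLlt : ∀ x ∈ L, x < n := fun x hx => hmem x (List.mem_append_left _ hx)
  have hRlt : ∀ x ∈ R, x < n := fun x hx => hmem x (List.mem_append_right _ hx)
  obtain ⟨m, l₁, l₂, hLm, hl₁, hl₂⟩ := exists_max_split hL hLn
  have hmL : m ∈ L := by simp [hLm]
  have hmB : m ∉ stackSort R := fun h => (List.disjoint_of_nodup_append hLR) hmL (mem_stackSort.1 h)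
  obtain ⟨b₁, b₂, c, hB, hc, hrun, hsB⟩ := stackRun_singleton_split hmB
  set A := stackSort l₁ ++ stackSort l₂ with hA
  have hAlt : ∀ x ∈ A, x < m := by
    intro x hx
    rcases List.mem_append.1 hx with h | h
    · exact hl₁ x (mem_stackSort.1 h)
    · exact hl₂ x (mem_stackSort.1 h)
  have hsL : stackSort L = A ++ [m] := by rw [hLm, stackSort_append_cons hl₁ hl₂]
  have hAL : (A ++ [m]).Perm L := hsL ▸ stackSort_perm L
  -- The image of the word under two passes consists of four consecutive blocks.
  have hrange : List.range n = stackSort A ++ (stackSort b₁ ++ m :: c) := by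
    have h1 : stackSort (stackSort L ++ stackSort R)
        = stackSort A ++ (stackSort b₁ ++ m :: c) := by
      rw [hsL, List.append_assoc, List.singleton_append, stackSort,
        stackRun_append_cons _ _ _ _ hAlt (by simp), hrun]
      rfl
    rw [← h1]
    rw [stackSort_append_cons hLlt hRlt, stackSort_append_cons (r := []), List.pairwise_append,
      List.pairwise_append] at hs
    · refine List.Perm.eq_of_pairwise (le := (· < ·)) (fun a b _ _ h h' => absurd h h'.asymm)
        List.pairwise_lt_range hs.1.1 ?_
      refine hLRp.symm.trans (List.Perm.trans ?_ (stackSort_perm _).symm)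
      exact (stackSort_perm L).symm.append (stackSort_perm R).symm
    · intro x hx
      rcases List.mem_append.1 hx with h | h
      · exact hLlt x (mem_stackSort.1 h)
      · exact hRlt x (mem_stackSort.1 h)
    · simp
  have hsorted : (stackSort A ++ (stackSort b₁ ++ m :: c)).Pairwise (· < ·) :=
    hrange ▸ List.pairwise_lt_range
  have hblocks := hrange
  rw [List.range_eq_range', List.range'_eq_append_iff] at hblocks
  obtain ⟨a, han, hra, hblocks⟩ := hblocks
  rw [eq_comm, List.range'_eq_append_iff] at hblocks
  obtain ⟨j, hjn, hrj, hblocks⟩ := hblocks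
  rw [eq_comm, List.range'_eq_cons_iff] at hblocks
  obtain ⟨hm, hpos, hrc⟩ := hblocks
  simp only [zero_add, mul_one] at hrj hm hrc
  have hAlen : A.length = a := by
    have := congrArg List.length hra
    rwa [stackSort_length, List.length_range'] at this
  have hb₁len : b₁.length = j := by
    have := congrArg List.length hrj
    rwa [stackSort_length, List.length_range'] at this
  have hAmem : ∀ x ∈ A, x < a := by
    intro x hx
    have := mem_stackSort.2 hx
    rw [hra, List.mem_range'_1] at this
    omega
  have hb₁mem : ∀ x ∈ b₁, a ≤ x ∧ x < a + j := by
    intro x hx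
    have := mem_stackSort.2 hx
    rwa [hrj, List.mem_range'_1] at this
  have hb₂mem : ∀ x ∈ b₂, a + j < x := by
    intro x hx
    have := hc.mem_iff.2 hx
    rw [hrc, List.mem_range'_1] at this
    omega
  have hLmem : ∀ x ∈ L, x < a ∨ x = a + j := by
    intro x hx
    rcases List.mem_append.1 (hAL.mem_iff.2 hx) with h | h
    · exact .inl (hAmem x h)
    · exact .inr (by rw [hm]; simpa using h)
  have hRmem : ∀ x ∈ R, a ≤ x ∧ x ≠ a + j := by
    intro x hx
    have hx' := mem_stackSort.2 hx
    rw [hB] at hx'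
    rcases List.mem_append.1 hx' with h | h
    · have := hb₁mem x h
      omega
    · have := hb₂mem x h
      omega
  have hLlen : L.length = a + 1 := by
    rw [← hAL.length_eq, List.length_append, hAlen, List.length_singleton]
  have hL' : L = (L.map fun x => if x < a then x else x - j).map (shiftTop a j) := by
    rw [List.map_map]
    nth_rewrite 1 [← List.map_id L]
    refine List.map_congr_left fun x hx => ?_
    have := hLmem x hx
    simp only [id, Function.comp_apply, shiftTop]
    split_ifs <;> omega
  have hR' : R = (R.map fun x => if x < a + j then x - a else x - a - 1).map (skipAt a j) := by
    rw [List.map_map]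
    nth_rewrite 1 [← List.map_id R]
    refine List.map_congr_left fun x hx => ?_
    have := hRmem x hx
    simp only [id, Function.comp_apply, skipAt]
    split_ifs <;> omega
  refine ⟨a, L.map fun x => if x < a then x else x - j,
    R.map fun x => if x < a + j then x - a else x - a - 1, j, hL', hR', ?_, ?_, ?_, ?_, ?_, ?_⟩
  · refine perm_range_of_nodup (List.Nodup.of_map (shiftTop a j) (hL' ▸ hLn)) ?_ (by simpa)
    rw [List.forall_mem_map]
    intro x hx
    have := hLmem x hx
    split_ifs <;> omega
  · refine perm_range_of_nodup (List.Nodup.of_map (skipAt a j) (hR' ▸ hRn)) ?_ rfl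
    rw [List.forall_mem_map, List.length_map]
    intro x hx
    have := hRmem x hx
    have := hRlt x hx
    split_ifs <;> omega
  · have h : (stackSort (stackSort L)).Pairwise (· < ·) := by
      rw [hsL, stackSort_append_cons hAlt (by simp)]
      refine hsorted.sublist ?_
      simp [stackSort, stackRun]
    rw [hL', stackSort_map (shiftTop_strictMono a j), stackSort_map (shiftTop_strictMono a j),
      List.pairwise_map] at h
    exact h.imp fun h => (shiftTop_strictMono a j).lt_iff_lt.1 h
  · have h : (stackSort (stackSort R)).Pairwise (· < ·) := by
      rw [hsB]
      refine hsorted.sublist ?_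
      refine List.Sublist.trans ?_ (List.sublist_append_right _ _)
      exact (List.Sublist.refl _).append (List.sublist_cons_self _ _)
    rw [hR', stackSort_map (skipAt_strictMono a j), stackSort_map (skipAt_strictMono a j),
      List.pairwise_map] at h
    exact h.imp fun h => (skipAt_strictMono a j).lt_iff_lt.1 h
  · rw [List.length_map]
    omega
  · generalize (R.map fun x => if x < a + j then x - a else x - a - 1) = r at *
    intro x hx
    have h1 := List.mem_map_of_mem (f := skipAt a j) hx
    rw [List.map_take, ← stackSort_map (skipAt_strictMono a j), ← hR', hB, ← hb₁len,
      List.take_left, hb₁len] at h1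
    have := (hb₁mem _ h1).2
    unfold skipAt at this
    split_ifs at this <;> omega

/-- Every `2`-stack sortable word occurs in `codes`, with its number of components. -/
theorem mem_codes (k : ℕ) : ∀ (d e : ℕ) (l : List ℕ), d + e = k →
    l.Perm (List.range (d + e + 1)) → descents l = d →
    (stackSort (stackSort l)).Pairwise (· < ·) → (l, numComponents l) ∈ codes d e := by
  induction k using Nat.strong_induction_on with
  | _ k ih =>
  intro d e l hk hl hd hs
  have hlen : l.length = d + e + 1 := by simpa using hl.length_eq
  obtain ⟨L, R, rfl⟩ := List.mem_iff_append.1 (hl.mem_iff.2 (List.mem_range.2 (Nat.lt_succ_self (d + e))))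
  have hnd := List.nodup_middle.1 (hl.nodup_iff.2 List.nodup_range)
  have hmem : ∀ x ∈ L ++ R, x < d + e := by
    intro x hx
    have h1 : x ∈ L ++ (d + e) :: R := by
      simp only [List.mem_append, List.mem_cons] at hx ⊢
      tauto
    have h2 := List.mem_range.1 (hl.subset h1)
    have h3 : x ≠ d + e := fun h => (List.nodup_cons.1 hnd).1 (h ▸ hx)
    omega
  have hLlt : ∀ x ∈ L, x < d + e := fun x hx => hmem x (List.mem_append_left _ hx)
  have hRlt : ∀ x ∈ R, x < d + e := fun x hx => hmem x (List.mem_append_right _ hx)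
  have hlen' : L.length + R.length = d + e := by
    simp at hlen
    omega
  have hLR : (L ++ R).Perm (List.range (d + e)) :=
    perm_range_of_nodup (List.nodup_cons.1 hnd).2 hmem (by simpa using hlen')
  have hdes := descents_append_cons R L hLlt
  rw [hd] at hdes
  rcases eq_or_ne L [] with rfl | hL
  · rcases eq_or_ne R [] with rfl | hR
    · -- The word has a single letter.
      simp at hlen'
      obtain ⟨rfl, rfl⟩ : d = 0 ∧ e = 0 := by omega
      have : numComponents [0] = 1 := by
        have := numComponents_append (l := []) (n := 0) (List.Perm.refl _)
        simpa [numComponents] using this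
      simp [codes, this]
    · -- The largest letter comes first.
      rw [descents_cons_of_forall_lt hR hRlt] at hdes
      simp only [descents, zero_add] at hdes
      subst hdes
      have hRs := stackSort_append_cons (l := []) (by simp) hRlt
      rw [List.nil_append] at hLR hl hs ⊢
      rw [List.nil_append] at hRs
      have h0 : stackSort ([] : List ℕ) = [] := rfl
      rw [hRs, h0, List.nil_append, stackSort_append_cons (r := [])
        (fun x hx => hRlt x (mem_stackSort.1 hx)) (by simp)] at hs
      have hRlen : R.length = descents R + 1 + e := by simpa using hlen'
      have h := ih (descents R + e) (by omega) (descents R) e R rfl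
        (by rwa [show descents R + e + 1 = descents R + 1 + e by omega]) rfl
        (List.pairwise_append.1 (List.pairwise_append.1 hs).1).1
      have := cons_mem_codes h
      rwa [numComponents_cons hLR, ← hRlen]
  · rcases eq_or_ne R [] with rfl | hR
    · -- The largest letter comes last.
      simp only [descents, add_zero] at hdes
      rw [List.append_nil] at hLR
      have hLlen : L.length = d + e := by simpa using hlen'
      have hlt := descents_lt_length hL
      obtain ⟨e, rfl⟩ : ∃ e', e = e' + 1 := ⟨e - 1, by omega⟩
      rw [stackSort_append_cons hLlt (by simp)] at hs
      have h0 : stackSort ([] : List ℕ) = [] := rfl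
      rw [h0, List.append_nil, stackSort_append_cons (r := [])
        (fun x hx => hLlt x (mem_stackSort.1 hx)) (by simp)] at hs
      have h := ih (d + e) (by omega) d e L rfl hLR hdes.symm
        (List.pairwise_append.1 (List.pairwise_append.1 hs).1).1
      have := append_mem_codes h
      rwa [numComponents_append hLR, ← hLlen]
    · -- The largest letter has letters on both sides.
      obtain ⟨a, l, r, j, rfl, rfl, hlp, hrp, hls, hrs, hjr, hcut⟩ := exists_glue hL hl hs
      have hla : l.length = a + 1 := by simpa using hlp.length_eq
      have hl0 : l ≠ [] := by simpa using hL
      have hr0 : r ≠ [] := by simpa using hR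
      rw [descents_cons_of_forall_lt hR hRlt, descents_map (shiftTop_strictMono a j),
        descents_map (skipAt_strictMono a j)] at hdes
      simp only [List.length_map] at hlen'
      have hdl := descents_lt_length hl0
      have hdr := descents_lt_length hr0
      have hglue : l.map (shiftTop a j) ++ (d + e) :: r.map (skipAt a j) = glue l r j := by
        rw [glue, hlen', hla, Nat.add_sub_cancel]
      obtain ⟨el, hel⟩ : ∃ x, l.length = descents l + x + 1 :=
        ⟨l.length - 1 - descents l, by omega⟩
      obtain ⟨er, her⟩ : ∃ x, r.length = descents r + x + 1 :=
        ⟨r.length - 1 - descents r, by omega⟩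
      have h1 := ih (descents l + el) (by omega) (descents l) el l rfl
        (by rwa [← hel, hla]) rfl hls
      have h2 := ih (descents r + er) (by omega) (descents r) er r rfl
        (by rwa [← her]) rfl hrs
      have h3 := glue_mem_codes h1 h2 (Nat.count_monotone (IsCut (stackSort r)) hjr)
      rw [Nat.nth_count hcut, ← numComponents_glue hlp hrp hjr] at h3
      rw [hglue]
      convert! h3 using 1
      congr 1
      omega

/-! ### The generating function of the encodings -/

section GeneratingFunction

open PowerSeries

theorem Multiset.sum_map_finset_sum {ι α M : Type*} [AddCommMonoid M] (s : Finset ι)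
    (m : ι → Multiset α) (f : α → M) :
    ((∑ i ∈ s, m i).map f).sum = ∑ i ∈ s, ((m i).map f).sum :=
  map_sum ((Multiset.sumAddMonoidHom : Multiset M →+ M).comp (Multiset.mapAddMonoidHom f)) m s

/-- The sum of `v ^ c` over the encodings with `d` descents and `e` ascents, where `v = 1 + z`. -/
noncomputable def codeWeight (d e : ℕ) : ℚ⟦X⟧ := ((codes d e).map fun t => (1 + X) ^ t.2).sum

/-- The sum of `1 + v + ⋯ + v ^ c` over the same encodings. -/
noncomputable def codeWeightGeom (d e : ℕ) : ℚ⟦X⟧ :=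
  ((codes d e).map fun t => ∑ i ∈ Finset.range (t.2 + 1), (1 + X) ^ i).sum

theorem constantCoeff_codeWeight (d e : ℕ) :
    constantCoeff (codeWeight d e) = ((codes d e).card : ℚ) := by
  rw [codeWeight, map_multiset_sum, Multiset.map_map]
  simp

theorem X_mul_codeWeightGeom (d e : ℕ) :
    X * codeWeightGeom d e = (1 + X) * codeWeight d e - C (constantCoeff (codeWeight d e)) := by
  rw [constantCoeff_codeWeight, codeWeight, codeWeightGeom]
  generalize codes d e = m
  induction m using Multiset.induction_on with
  | empty => simp
  | cons t m ih =>
    have h := mul_geom_sum (1 + X : ℚ⟦X⟧) (t.2 + 1)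
    rw [add_sub_cancel_left] at h
    simp only [Multiset.map_cons, Multiset.sum_cons, Multiset.card_cons, mul_add, ih, h]
    push_cast
    simp only [map_add, map_one]
    ring

theorem sum_map_glue (m₁ m₂ : Multiset (List ℕ × ℕ)) :
    ((m₁.bind fun s => m₂.bind fun t => (Multiset.range (t.2 + 1)).map fun j =>
        (glue s.1 t.1 (Nat.nth (IsCut (stackSort t.1)) j), s.2 + (t.2 - j) + 1)).map
      fun t => (1 + X : ℚ⟦X⟧) ^ t.2).sum
    = (1 + X) * ((m₁.map fun t => (1 + X) ^ t.2).sum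
        * (m₂.map fun t => ∑ i ∈ Finset.range (t.2 + 1), (1 + X) ^ i).sum) := by
  have hj : ∀ a c : ℕ, ((Multiset.range (c + 1)).map
      fun j => (1 + X : ℚ⟦X⟧) ^ (a + (c - j) + 1)).sum
      = (1 + X) * (1 + X) ^ a * ∑ i ∈ Finset.range (c + 1), (1 + X) ^ i := by
    intro a c
    change ∑ j ∈ Finset.range (c + 1), (1 + X : ℚ⟦X⟧) ^ (a + (c - j) + 1) = _
    rw [← Finset.sum_range_reflect, Finset.mul_sum]
    refine Finset.sum_congr rfl fun j hj => ?_
    have := Finset.mem_range.1 hj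
    rw [show c - (c + 1 - 1 - j) = j by omega]
    ring
  simp only [Multiset.map_bind, Multiset.sum_bind, Multiset.map_map, Function.comp_def, hj,
    Multiset.sum_map_mul_left, Multiset.sum_map_mul_right]
  ring

theorem sum_map_shift (m : Multiset (List ℕ × ℕ)) (g : List ℕ → List ℕ) :
    ((m.map fun t => (g t.1, t.2 + 1)).map fun t => (1 + X : ℚ⟦X⟧) ^ t.2).sum
      = (1 + X) * (m.map fun t => (1 + X) ^ t.2).sum := by
  rw [Multiset.map_map, ← Multiset.sum_map_mul_left]
  simp only [Function.comp_def, pow_succ']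

/-- The generating function of the encodings. -/
noncomputable def codeSeries : ℚ⟦X⟧⟦X⟧⟦X⟧ :=
  PowerSeries.mk fun d => PowerSeries.mk fun e => codeWeight d e

/-- The divided difference `(v F - F₁) / (v - 1)` of the generating function `F`. -/
noncomputable def codeSeriesGeom : ℚ⟦X⟧⟦X⟧⟦X⟧ :=
  PowerSeries.mk fun d => PowerSeries.mk fun e => codeWeightGeom d e

theorem codeSeries_eq : codeSeries = (1 + C (C X)) * (1 + X * codeSeries + C X * codeSeries
    + X * (C X * (codeSeries * codeSeriesGeom))) := by
  have hv : (1 + C (C X) : ℚ⟦X⟧⟦X⟧⟦X⟧) = C (C (1 + X)) := by simp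
  ext1 d
  ext1 e
  rw [hv, coeff_C_mul, coeff_C_mul]
  cases d with
  | zero =>
    cases e with
    | zero =>
      simp [codeSeries, codeWeight, codes]
    | succ e =>
      simp only [map_add, coeff_zero_X_mul, coeff_C_mul, coeff_succ_X_mul, add_zero]
      simp only [codeSeries, coeff_mk, codeWeight, codes, coeff_one]
      rw [sum_map_shift _ fun l => l ++ [l.length]]
      simp [coeff_one]
  | succ d =>
    cases e with
    | zero =>
      simp only [map_add, coeff_zero_X_mul, coeff_C_mul, coeff_succ_X_mul, add_zero]
      simp only [codeSeries, coeff_mk, codeWeight, codes, coeff_one]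
      rw [sum_map_shift _ fun l => l.length :: l]
      simp
    | succ e =>
      simp only [map_add, coeff_C_mul, coeff_succ_X_mul]
      rw [coeff_mul, map_sum]
      simp only [coeff_mul, codeSeries, codeSeriesGeom, coeff_mk, coeff_one, codeWeight,
        codeWeightGeom]
      rw [codes, Multiset.map_add, Multiset.map_add, Multiset.sum_add,
        Multiset.sum_add, sum_map_shift _ fun l => l ++ [l.length],
        sum_map_shift _ fun l => l.length :: l, Multiset.sum_map_finset_sum]
      simp only [Multiset.sum_map_finset_sum, sum_map_glue]
      rw [Finset.Nat.sum_antidiagonal_eq_sum_range_succ_mk, Finset.sum_range]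
      simp only [Finset.Nat.sum_antidiagonal_eq_sum_range_succ_mk, Finset.sum_range,
        ← Finset.mul_sum]
      simp
      ring

theorem codeSeries_catalyticEq : CatalyticEq codeSeries := by
  have h : C (C X) * codeSeriesGeom
      = (1 + C (C X)) * codeSeries - inclConst (evalZero codeSeries) := by
    have hv : (1 + C (C X) : ℚ⟦X⟧⟦X⟧⟦X⟧) = C (C (1 + X)) := by simp
    ext1 d
    ext1 e
    rw [hv]
    simp only [map_sub, coeff_C_mul, inclConst, evalZero, coeff_map, codeSeries, codeSeriesGeom,
      coeff_mk, X_mul_codeWeightGeom]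
  unfold CatalyticEq
  rw [← h]
  nth_rewrite 1 [codeSeries_eq]
  ring

theorem card_codes (d e : ℕ) : ((codes d e).card : ℚ)
    = (((2 * d + e + 1)! * (d + 2 * e + 1)! : ℕ) : ℚ) /
        (((d + 1)! * (e + 1)! * (2 * d + 1)! * (2 * e + 1)! : ℕ) : ℚ) := by
  rw [← coeff_closedSeries, ← evalZero_eq_closedSeries codeSeries_catalyticEq]
  simp [evalZero, codeSeries, constantCoeff_codeWeight]

end GeneratingFunction

/-! ### Stack words and the size of the fibres -/

section TaggedRun

variable {α : Type*} [LinearOrder α]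

/-- The run of the stack in single steps, each output letter being paired with the number of pushes
since the previous pop. The third argument counts the pushes since the last pop. -/
def taggedRun : List α → List α → ℕ → List (α × ℕ)
  | [], [], _ => []
  | [], r :: st, c => (r, c) :: taggedRun [] st 0
  | x :: l, [], c => taggedRun l [x] (c + 1)
  | x :: l, r :: st, c =>
    if x < r then taggedRun l (x :: r :: st) (c + 1) else (r, c) :: taggedRun (x :: l) st 0
  termination_by l st => 2 * l.length + st.length

theorem map_fst_taggedRun (l st : List α) (c : ℕ) :
    (taggedRun l st c).map Prod.fst = stackRun l st := by
  induction l, st, c using taggedRun.induct with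
  | case1 => simp [taggedRun, stackRun]
  | case2 r st c ih =>
    simp only [stackRun] at ih
    simp [taggedRun, stackRun, ih]
  | case3 x l c ih => simp [taggedRun, stackRun, ih]
  | case4 x l r st c h ih => simp [taggedRun, stackRun, ih, h]
  | case5 x l r st c h ih =>
    rw [taggedRun, if_neg h, List.map_cons, ih]
    simp [stackRun, not_lt.1 h]

theorem length_taggedRun (l st : List α) (c : ℕ) :
    (taggedRun l st c).length = l.length + st.length := by
  rw [← List.length_map (f := Prod.fst), map_fst_taggedRun, (stackRun_perm l st).length_eq,
    List.length_append]

theorem le_of_taggedRun_eq_cons {l st : List α} {c : ℕ} {p : α × ℕ} {T : List (α × ℕ)}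
    (h : taggedRun l st c = p :: T) : c ≤ p.2 := by
  induction l, st, c using taggedRun.induct with
  | case1 => simp [taggedRun] at h
  | case2 r st c ih =>
    rw [taggedRun, List.cons.injEq] at h
    rw [← h.1]
  | case3 x l c ih =>
    rw [taggedRun] at h
    have := ih h
    omega
  | case4 x l r st c hx ih =>
    rw [taggedRun, if_pos hx] at h
    have := ih h
    omega
  | case5 x l r st c hx ih =>
    rw [taggedRun, if_neg hx, List.cons.injEq] at h
    rw [← h.1]

/-- The word and the stack can be recovered from the tagged output by running backwards. -/
theorem taggedRun_injective {l st l' st' : List α} {c : ℕ}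
    (h : taggedRun l st c = taggedRun l' st' c) : l = l' ∧ st = st' := by
  have hlen := congrArg List.length h
  rw [length_taggedRun, length_taggedRun] at hlen
  induction l, st, c using taggedRun.induct generalizing l' st' with
  | case1 => simpa [eq_comm] using hlen
  | case2 r st c ih =>
    rw [taggedRun] at h
    match l', st' with
    | [], [] => simp at hlen
    | [], r' :: st' =>
      rw [taggedRun, List.cons.injEq, Prod.mk.injEq] at h
      have := ih h.2 (by simpa using hlen)
      simp [h.1.1, this.2]
    | x' :: l', [] =>
      rw [taggedRun] at h
      have := le_of_taggedRun_eq_cons h.symm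
      simp at this
    | x' :: l', r' :: st' =>
      rw [taggedRun] at h
      split_ifs at h with hx
      · have := le_of_taggedRun_eq_cons h.symm
        simp at this
      · rw [List.cons.injEq] at h
        have := ih h.2 (by simp at hlen ⊢; omega)
        simp at this
  | case3 x l c ih =>
    rw [taggedRun] at h
    match l', st' with
    | [], [] => simp at hlen
    | [], r' :: st' =>
      rw [taggedRun] at h
      have := le_of_taggedRun_eq_cons h
      simp at this
    | x' :: l', [] =>
      rw [taggedRun] at h
      have := ih h (by simpa using hlen)
      simpa [and_comm] using this
    | x' :: l', r' :: st' =>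
      rw [taggedRun] at h
      split_ifs at h with hx
      · have := ih h (by simp at hlen ⊢; omega)
        simp at this
      · have := le_of_taggedRun_eq_cons h
        simp at this
  | case4 x l r st c hxr ih =>
    rw [taggedRun, if_pos hxr] at h
    match l', st' with
    | [], [] => simp at hlen
    | [], r' :: st' =>
      rw [taggedRun] at h
      have := le_of_taggedRun_eq_cons h
      simp at this
    | x' :: l', [] =>
      rw [taggedRun] at h
      have := ih h (by simp at hlen ⊢; omega)
      simp at this
    | x' :: l', r' :: st' =>
      rw [taggedRun] at h
      split_ifs at h with hx
      · have := ih h (by simp at hlen ⊢; omega)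
        simp at this ⊢
        tauto
      · have := le_of_taggedRun_eq_cons h
        simp at this
  | case5 x l r st c hxr ih =>
    rw [taggedRun, if_neg hxr] at h
    match l', st' with
    | [], [] => simp at hlen
    | [], r' :: st' =>
      rw [taggedRun, List.cons.injEq] at h
      have := ih h.2 (by simp at hlen ⊢; omega)
      simp at this
    | x' :: l', [] =>
      rw [taggedRun] at h
      have := le_of_taggedRun_eq_cons h.symm
      simp at this
    | x' :: l', r' :: st' =>
      rw [taggedRun] at h
      split_ifs at h with hx
      · have := le_of_taggedRun_eq_cons h.symm
        simp at this
      · rw [List.cons.injEq, Prod.mk.injEq] at h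
        have := ih h.2 (by simp at hlen ⊢; omega)
        simp [h.1.1, this]

theorem sum_taggedRun (l st : List α) (c : ℕ) (h : c = 0 ∨ l ≠ [] ∨ st ≠ []) :
    ((taggedRun l st c).map Prod.snd).sum = c + l.length := by
  induction l, st, c using taggedRun.induct with
  | case1 => simpa [taggedRun, eq_comm] using h
  | case2 r st c ih => simp [taggedRun, ih]
  | case3 x l c ih =>
    simp [taggedRun, ih]
    omega
  | case4 x l r st c hx ih =>
    simp [taggedRun, ih, hx]
    omega
  | case5 x l r st c hx ih => simp [taggedRun, ih, hx]

theorem head_taggedRun_cons (l st : List α) (x : α) {p : α × ℕ} {T : List (α × ℕ)}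
    (h : taggedRun l (x :: st) 1 = p :: T) : p.1 = x ∨ 2 ≤ p.2 := by
  cases l with
  | nil =>
    rw [taggedRun, List.cons.injEq] at h
    exact .inl (by rw [← h.1])
  | cons y l =>
    rw [taggedRun] at h
    split_ifs at h with hy
    · exact .inr (le_of_taggedRun_eq_cons h)
    · rw [List.cons.injEq] at h
      exact .inl (by rw [← h.1])

/-- If no letter of the stack and no letter about to be pushed is less than `r`, then the next letter
to leave can be less than `r` only after at least two pushes. -/
theorem head_taggedRun {l st : List α} {r : α} (hl : ∀ x ∈ l.head?, r ≤ x) (hst : ∀ x ∈ st, r ≤ x)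
    {p : α × ℕ} {T : List (α × ℕ)} (h : taggedRun l st 0 = p :: T) : r ≤ p.1 ∨ 2 ≤ p.2 := by
  match l, st with
  | [], [] => simp [taggedRun] at h
  | [], s :: st =>
    rw [taggedRun, List.cons.injEq] at h
    exact .inl (by rw [← h.1]; exact hst s (by simp))
  | x :: l, [] =>
    rw [taggedRun] at h
    exact (head_taggedRun_cons l [] x h).imp_left fun h' => by rw [h']; exact hl x (by simp)
  | x :: l, s :: st =>
    rw [taggedRun] at h
    split_ifs at h with hx
    · exact (head_taggedRun_cons l (s :: st) x h).imp_left fun h' => by rw [h']; exact hl x (by simp)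
    · rw [List.cons.injEq] at h
      exact .inl (by rw [← h.1]; exact hst s (by simp))

/-- Between the two pops of a descent there are at least two pushes. -/
theorem isChain_taggedRun (l st : List α) (c : ℕ) (hst : st.Pairwise (· ≤ ·)) :
    (taggedRun l st c).IsChain fun p q => p.1 ≤ q.1 ∨ 2 ≤ q.2 := by
  induction l, st, c using taggedRun.induct with
  | case1 => simp [taggedRun]
  | case2 r st c ih =>
    rw [List.pairwise_cons] at hst
    rw [taggedRun, List.isChain_cons]
    refine ⟨fun q hq => ?_, ih hst.2⟩
    obtain ⟨T, hT⟩ := List.head?_eq_some_iff.1 hq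
    exact head_taggedRun (by simp) hst.1 hT
  | case3 x l c ih =>
    rw [taggedRun]
    exact ih (by simp)
  | case4 x l r st c hx ih =>
    rw [taggedRun, if_pos hx]
    refine ih (List.pairwise_cons.2 ⟨fun y hy => ?_, hst⟩)
    rcases List.mem_cons.1 hy with rfl | hy
    · exact hx.le
    · exact hx.le.trans ((List.pairwise_cons.1 hst).1 y hy)
  | case5 x l r st c hx ih =>
    rw [List.pairwise_cons] at hst
    rw [taggedRun, if_neg hx, List.isChain_cons]
    refine ⟨fun q hq => ?_, ih hst.2⟩
    obtain ⟨T, hT⟩ := List.head?_eq_some_iff.1 hq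
    exact head_taggedRun (by simpa using hx) hst.1 hT

/-- The push counts, lowered by the compulsory two at each letter less than its predecessor; the
first argument is the predecessor of the first letter. -/
def reduceTags : α → List (α × ℕ) → List ℕ
  | _, [] => []
  | r, p :: T => (if p.1 < r then p.2 - 2 else p.2) :: reduceTags p.1 T

theorem length_reduceTags (r : α) (T : List (α × ℕ)) : (reduceTags r T).length = T.length := by
  induction T generalizing r with
  | nil => rfl
  | cons p T ih => simp [reduceTags, ih]

theorem sum_reduceTags (p : α × ℕ) (T : List (α × ℕ))
    (h : (p :: T).IsChain fun p q => p.1 ≤ q.1 ∨ 2 ≤ q.2) :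
    (reduceTags p.1 T).sum + 2 * descents ((p :: T).map Prod.fst) = (T.map Prod.snd).sum := by
  induction T generalizing p with
  | nil => rfl
  | cons q T ih =>
    rw [List.isChain_cons_cons] at h
    have := ih q h.2
    simp only [List.map_cons, reduceTags, List.sum_cons, descents] at this ⊢
    rcases h.1 with h1 | h1
    · simp only [h1.not_gt, if_false]
      omega
    · split_ifs <;> omega

theorem reduceTags_injective (p p' : α × ℕ) (T T' : List (α × ℕ)) (hp : p.1 = p'.1)
    (h : (p :: T).IsChain fun p q => p.1 ≤ q.1 ∨ 2 ≤ q.2)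
    (h' : (p' :: T').IsChain fun p q => p.1 ≤ q.1 ∨ 2 ≤ q.2)
    (hfst : T.map Prod.fst = T'.map Prod.fst)
    (hred : reduceTags p.1 T = reduceTags p'.1 T') : T = T' := by
  induction T generalizing p p' T' with
  | nil => exact (List.map_eq_nil_iff.1 hfst.symm).symm
  | cons q T ih =>
    cases T' with
    | nil => simp at hfst
    | cons q' T' =>
      rw [List.isChain_cons_cons] at h h'
      simp only [List.map_cons, List.cons.injEq, reduceTags] at hfst hred
      refine List.cons_eq_cons.2 ⟨?_, ih q q' T' hfst.1 h.2 h'.2 hfst.2 hred.2⟩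
      refine Prod.ext hfst.1 ?_
      have h0 := hred.1
      have h1 := h.1
      have h2 := h'.1
      rw [← hfst.1, ← hp] at h0 h2
      split_ifs at h0 with hlt
      · have := h1.resolve_left hlt.not_ge
        have := h2.resolve_left hlt.not_ge
        omega
      · exact h0

end TaggedRun

theorem card_le_choose_of_length_of_sum {S : Finset (List ℕ)} {n m : ℕ}
    (h : ∀ l ∈ S, l.length = n ∧ l.sum = m) : S.card ≤ (n + m - 1).choose m := by
  have hof : ∀ l ∈ S, List.ofFn (fun i : Fin n => l.getD i 0) = l := by
    intro l hl
    refine List.ext_getElem (by simp [(h l hl).1]) fun i h1 h2 => ?_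
    rw [List.getElem_ofFn]
    simp [h2]
  have hsum : ∀ l : S, ∑ i : Fin n, l.1.getD i 0 = m := by
    intro l
    rw [← List.sum_ofFn, hof l l.2, (h l l.2).2]
  have hinj : Function.Injective fun l : S =>
      (Sym.equivNatSumOfFintype (Fin n) m).symm ⟨fun i => l.1.getD i 0, hsum l⟩ := by
    intro l l' hll
    have h1 := Subtype.ext_iff.1 ((Sym.equivNatSumOfFintype (Fin n) m).symm.injective hll)
    exact Subtype.ext ((hof l l.2).symm.trans ((congrArg List.ofFn h1).trans (hof l' l'.2)))
  have := Fintype.card_le_of_injective _ hinj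
  rwa [Fintype.card_coe, Sym.card_sym_eq_choose, Fintype.card_fin] at this

section Fibers

variable {α : Type*} [LinearOrder α]

/-- The numbers of pushes between consecutive pops, lowered by the compulsory ones: one before the
first pop and two at each descent of the output. -/
def excessPushes (p : List α) : List ℕ :=
  match taggedRun p [] 0 with
  | [] => []
  | q :: T => (q.2 - 1) :: reduceTags q.1 T

theorem exists_taggedRun_eq_cons {p : List α} (hp : p ≠ []) : ∃ q T, taggedRun p [] 0 = q :: T ∧
    1 ≤ q.2 ∧ (q :: T).IsChain fun p q => p.1 ≤ q.1 ∨ 2 ≤ q.2 := by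
  cases p with
  | nil => exact absurd rfl hp
  | cons x p =>
    cases h : taggedRun (x :: p) [] 0 with
    | nil =>
      have := congrArg List.length h
      rw [length_taggedRun] at this
      simp at this
    | cons q T =>
      refine ⟨q, T, rfl, ?_, h ▸ isChain_taggedRun _ _ _ List.Pairwise.nil⟩
      rw [taggedRun] at h
      exact le_of_taggedRun_eq_cons h

theorem length_excessPushes (p : List α) : (excessPushes p).length = p.length := by
  have h := length_taggedRun p [] 0
  unfold excessPushes
  split
  · next h0 => simpa [h0] using h
  · next q T h0 => simpa [h0, length_reduceTags] using h

theorem sum_excessPushes {p : List α} (hp : p ≠ []) :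
    (excessPushes p).sum + 1 + 2 * descents (stackSort p) = p.length := by
  obtain ⟨q, T, h, hq, hc⟩ := exists_taggedRun_eq_cons hp
  have h1 := sum_taggedRun p [] 0 (.inl rfl)
  have h2 := sum_reduceTags q T hc
  rw [← h, map_fst_taggedRun] at h2
  rw [h, List.map_cons, List.sum_cons] at h1
  simp only [excessPushes, h, List.sum_cons, stackSort]
  omega

theorem excessPushes_injective {p p' : List α} (hp : p ≠ []) (hp' : p' ≠ [])
    (hs : stackSort p = stackSort p') (he : excessPushes p = excessPushes p') : p = p' := by
  obtain ⟨q, T, h, hq, hc⟩ := exists_taggedRun_eq_cons hp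
  obtain ⟨q', T', h', hq', hc'⟩ := exists_taggedRun_eq_cons hp'
  simp only [excessPushes, h, h', List.cons.injEq] at he
  unfold stackSort at hs
  rw [← map_fst_taggedRun p [] 0, ← map_fst_taggedRun p' [] 0, h, h', List.map_cons, List.map_cons,
    List.cons.injEq] at hs
  have hT := reduceTags_injective q q' T T' hs.1 hc hc' hs.2 he.2
  have hqq : q = q' := Prod.ext hs.1 (by omega)
  refine (taggedRun_injective (c := 0) (st := []) (st' := []) ?_).1
  rw [h, h', hT, hqq]

/-- A word of length `n` with `k - 1` descents has at most `(2n - 2k).choose (n - 1)` preimages under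
the stack, the number of ways to distribute `n - 2k + 1` free pushes among `n` pops. -/
theorem card_fiber_le {S : Finset (List α)} {n : ℕ} (hn : 1 ≤ n) {q : List α}
    (h : ∀ p ∈ S, p.length = n ∧ stackSort p = q) :
    S.card ≤ (2 * n - 2 * (descents q + 1)).choose (n - 1) := by
  rcases S.eq_empty_or_nonempty with rfl | ⟨p₀, hp₀⟩
  · simp
  have hne : ∀ p ∈ S, p ≠ [] := by
    rintro p hp rfl
    have := (h _ hp).1
    simp at this
    omega
  have hsum : ∀ p ∈ S, (excessPushes p).sum + 1 + 2 * descents q = n := by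
    intro p hp
    rw [← (h p hp).2, sum_excessPushes (hne p hp), (h p hp).1]
  have h0 := hsum p₀ hp₀
  set m := (excessPushes p₀).sum
  have hinj : Set.InjOn excessPushes (S : Set (List α)) := fun p hp p' hp' he =>
    excessPushes_injective (hne p hp) (hne p' hp') ((h p hp).2.trans (h p' hp').2.symm) he
  rw [← Finset.card_image_of_injOn hinj]
  have hle : (S.image excessPushes).card ≤ (n + m - 1).choose m := by
    refine card_le_choose_of_length_of_sum fun l hl => ?_
    obtain ⟨p, hp, rfl⟩ := Finset.mem_image.1 hl
    refine ⟨by rw [length_excessPushes, (h p hp).1], ?_⟩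
    have := hsum p hp
    omega
  refine hle.trans (le_of_eq ?_)
  rw [show 2 * n - 2 * (descents q + 1) = n + m - 1 by omega]
  exact Nat.choose_symm_of_eq_add (by omega)

end Fibers

/-- The permutations of `{0, …, n - 1}`, as words over `ℕ`, that are sorted by `t` passes. -/
def sortableWords (t n : ℕ) : Finset (List ℕ) :=
  (List.range n).permutations.toFinset.filter fun l => stackSort^[t] l = List.range n

theorem mem_sortableWords {t n : ℕ} {l : List ℕ} :
    l ∈ sortableWords t n ↔ l.Perm (List.range n) ∧ stackSort^[t] l = List.range n := by
  simp [sortableWords]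

theorem iterate_stackSort_map {α β : Type*} [LinearOrder α] [LinearOrder β] {f : α → β}
    (hf : StrictMono f) (t : ℕ) (l : List α) :
    stackSort^[t] (l.map f) = (stackSort^[t] l).map f := by
  induction t generalizing l with
  | zero => rfl
  | succ t ih => rw [Function.iterate_succ_apply, stackSort_map hf, ih, Function.iterate_succ_apply]

theorem numStackSortable_le_card (t n : ℕ) : numStackSortable t n ≤ (sortableWords t n).card := by
  have hmem : ∀ p : {p : Equiv.Perm (Fin n) // IsStackSortable t p},
      (List.ofFn p.1).map Fin.val ∈ sortableWords t n := by
    intro p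
    rw [mem_sortableWords]
    constructor
    · refine perm_range_of_nodup ?_ ?_ (by simp)
      · exact (List.nodup_ofFn.2 p.1.injective).map Fin.val_injective
      · rw [List.forall_mem_map]
        exact fun x _ => x.2
    · rw [iterate_stackSort_map Fin.val_strictMono, p.2]
      simp
  have hinj : Function.Injective fun p : {p : Equiv.Perm (Fin n) // IsStackSortable t p} =>
      (⟨_, hmem p⟩ : sortableWords t n) := by
    intro p p' h
    have h1 := List.map_injective_iff.2 Fin.val_injective (Subtype.ext_iff.1 h)
    exact Subtype.ext (Equiv.coe_fn_injective (List.ofFn_injective h1))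
  have := Nat.card_le_card_of_injective _ hinj
  rwa [Nat.card_eq_fintype_card (α := sortableWords t n), Fintype.card_coe] at this

theorem card_sortableWords_two_le (d e : ℕ) :
    ((sortableWords 2 (d + e + 1)).filter fun q => descents q = d).card ≤ (codes d e).card := by
  classical
  refine le_trans ?_ (Multiset.toFinset_card_le (codes d e))
  refine Finset.card_le_card_of_injOn (fun q => (q, numComponents q)) ?_
    fun q _ q' _ h => (Prod.ext_iff.1 h).1
  intro q hq
  obtain ⟨hq, hd⟩ := Finset.mem_filter.1 hq
  obtain ⟨hp, hs⟩ := mem_sortableWords.1 hq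
  rw [Finset.mem_coe, Multiset.mem_toFinset]
  refine mem_codes _ d e q rfl hp hd ?_
  change stackSort (stackSort q) = _ at hs
  rw [hs]
  exact List.pairwise_lt_range

/-! ### The bound -/

theorem mainTheorem2 (n : ℕ) (hn : 1 ≤ n) :
    (numStackSortable 3 n : ℚ) ≤
      ∑ k ∈ Finset.Icc 1 ((n + 1) / 2),
        (((n + k - 1)! * (2 * n - k)! : ℕ) : ℚ) /
            ((k ! * (n + 1 - k)! * (2 * k - 1)! * (2 * n - 2 * k + 1)! : ℕ) : ℚ) *
          ((2 * n - 2 * k).choose (n - 1) : ℚ) := by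
  have hlen : ∀ p ∈ sortableWords 3 n, p.length = n := fun p hp => by
    simpa using (mem_sortableWords.1 hp).1.length_eq
  -- Only images with at most `(n + 1) / 2 - 1` descents have preimages at all.
  set T := (sortableWords 2 n).filter fun q => descents q + 1 ∈ Finset.Icc 1 ((n + 1) / 2) with hT
  have hmap : Set.MapsTo stackSort (sortableWords 3 n : Set (List ℕ)) (T : Set (List ℕ)) := by
    intro p hp
    have hpl := hlen p hp
    have hp0 : p ≠ [] := by
      rintro rfl
      simp at hpl
      omega
    have hs := sum_excessPushes hp0
    rw [Finset.mem_coe, mem_sortableWords] at hp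
    rw [Finset.mem_coe, hT, Finset.mem_filter, mem_sortableWords, Finset.mem_Icc]
    exact ⟨⟨(stackSort_perm p).trans hp.1, hp.2⟩, by omega, by omega⟩
  have h1 : numStackSortable 3 n
      ≤ ∑ q ∈ T, (2 * n - 2 * (descents q + 1)).choose (n - 1) := by
    refine (numStackSortable_le_card 3 n).trans ?_
    rw [Finset.card_eq_sum_card_fiberwise hmap]
    refine Finset.sum_le_sum fun q _ => card_fiber_le hn fun p hp => ?_
    rw [Finset.mem_filter] at hp
    exact ⟨hlen p hp.1, hp.2⟩
  rw [← Finset.sum_fiberwise_of_maps_to (t := Finset.Icc 1 ((n + 1) / 2))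
    (g := fun q => descents q + 1) fun q hq => (Finset.mem_filter.1 hq).2] at h1
  refine (Nat.cast_le.2 h1).trans ?_
  rw [Nat.cast_sum]
  refine Finset.sum_le_sum fun k hk => ?_
  rw [Finset.mem_Icc] at hk
  obtain ⟨d, rfl⟩ : ∃ d, k = d + 1 := ⟨k - 1, by omega⟩
  obtain ⟨e, rfl⟩ : ∃ e, n = d + e + 1 := ⟨n - 1 - d, by omega⟩
  have h2 : ∑ q ∈ T with descents q + 1 = d + 1,
      (2 * (d + e + 1) - 2 * (descents q + 1)).choose (d + e + 1 - 1)
      ≤ (codes d e).card * (2 * (d + e + 1) - 2 * (d + 1)).choose (d + e + 1 - 1) := by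
    rw [Finset.sum_congr rfl fun q hq => by rw [(Finset.mem_filter.1 hq).2], Finset.sum_const,
      smul_eq_mul]
    refine Nat.mul_le_mul_right _ ((Finset.card_le_card fun q hq => ?_).trans
      (card_sortableWords_two_le d e))
    rw [Finset.mem_filter] at hq ⊢
    exact ⟨(Finset.mem_filter.1 hq.1).1, by omega⟩
  refine (Nat.cast_le.2 h2).trans (le_of_eq ?_)
  rw [Nat.cast_mul, card_codes]
  rw [show d + e + 1 + (d + 1) - 1 = 2 * d + e + 1 by omega,
    show 2 * (d + e + 1) - (d + 1) = d + 2 * e + 1 by omega,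
    show d + e + 1 + 1 - (d + 1) = e + 1 by omega,
    show 2 * (d + 1) - 1 = 2 * d + 1 by omega,
    show 2 * (d + e + 1) - 2 * (d + 1) + 1 = 2 * e + 1 by omega]
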